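/- Let $n\ge 1$, and write permutations of $[n]=\{1,\dots,n\}$ as words $\pi=\pi_1\cdots\pi_n$. Let $\mathfrak S_n(2413,3142)$ be the set of permutations of $[n]$ that avoid both patterns $2413$ and $3142$ (the separable permutations). Put $$\mathrm{LMAX}(\pi)=\{\pi_i:\pi_j<\pi_i\ \forall j<i\},\quad \mathrm{LMIN}(\pi)=\{\pi_i:\pi_j>\pi_i\ \forall j<i\},\quad \mathrm{DESB}(\pi)=\{\pi_{i+1}:1\le i<n,\ \pi_i>\pi_{i+1}\}.$$ A di-sk tree is a (possibly empty) binary tree, with left and right children distinguished, whose nodes are labeled $\oplus$ or $\ominus$ and in which no node has the same label as its right child. Let $\mathfrak{DT}_n$ be the set of di-sk trees with $n-1$ nodes. The spine of $T$ is the path from its root to its first node in inorder (left subtree, node, right subtree); it is empty if $T$ is. Let $\mathsf{top}(T)$ be the number of consecutive $\oplus$-nodes at the top of the spine, and $\mathsf{iop}(T)$ the number of initial $\oplus$-nodes of $T$ in inorder. The bijection $\eta:\mathfrak S_n(2413,3142)\to\mathfrak{DT}_n$ is defined recursively: $\eta(1)=\emptyset$; for $n\ge2$ let $i\in[n-1]$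 be the greatest index such that all of $\pi_1,\dots,\pi_i$ are larger than, or all are smaller than, all of $\pi_{i+1},\dots,\pi_n$. In the first case the root of $\eta(\pi)$ is $\ominus$, in the second it is $\oplus$; its left and right subtrees are $\eta(\omega)$ and $\eta(\rho)$, where $\omega$ and $\rho$ are the permutations of $[i]$ and $[n-i]$ order isomorphic to $\pi_1\cdots\pi_i$ and $\pi_{i+1}\cdots\pi_n$. For $k,l\ge0$ let $\widetilde{\mathfrak{DT}}_n^{(k,l)}$ be the set of $T\in\mathfrak{DT}_n$ whose spine contains at least one $\ominus$-node and for which $\mathsf{top}(T)=k$ and $\mathsf{iop}(T)=l$. **Theorem.** For all $n\ge1$, $k\ge1$ and $l\ge0$ there is a bijection $\phi:\widetilde{\mathfrak{DT}}_n^{(k,l)}\to\widetilde{\mathfrak{DT}}_n^{(k-1,l+1)}$ such that for every $T\in\widetilde{\mathfrak{DT}}_n^{(k,l)}$ the permutations $\eta^{-1}(T)$ and $\eta^{-1}(\phi(T))$ have the same $\mathrm{DESB}$, the same $\mathrm{LMAX}$ and the same $\mathrm{LMIN}$. -/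

import Mathlib

namespace DiSk

/-! ### Permutations in one-line notation and pattern avoidance -/

/-- `w = π₁ π₂ ⋯ πₙ` is (the one-line notation of) a permutation of `[n] = {1, …, n}`. -/
def IsPerm (n : ℕ) (w : List ℕ) : Prop :=
  w.Perm (List.range' 1 n)

/-- Two words have the same length and their letters compare in the same way. -/
def OrderIsomorphic (u p : List ℕ) : Prop :=
  ∃ h : u.length = p.length, ∀ i j : Fin u.length,
    u.get i < u.get j ↔ p.get (i.cast h) < p.get (j.cast h)

/-- No subsequence of `w` is order isomorphic to the pattern `p`. -/
def Avoids (w p : List ℕ) : Prop :=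
  ¬ ∃ u : List ℕ, u.Sublist w ∧ OrderIsomorphic u p

/-- The separable permutations of `[n]`: those avoiding both `2413` and `3142`. -/
def SepPerm (n : ℕ) : Type :=
  {w : List ℕ // IsPerm n w ∧ Avoids w [2, 4, 1, 3] ∧ Avoids w [3, 1, 4, 2]}

/-- Values of left-to-right maxima: letters larger than all letters to their left. -/
def LMAX (w : List ℕ) : Set ℕ :=
  {x | ∃ u v : List ℕ, w = u ++ x :: v ∧ ∀ y ∈ u, y < x}

/-- Values of left-to-right minima: letters smaller than all letters to their left. -/
def LMIN (w : List ℕ) : Set ℕ :=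
  {x | ∃ u v : List ℕ, w = u ++ x :: v ∧ ∀ y ∈ u, x < y}

/-- Descent bottoms: letters that are smaller than the letter immediately to their left. -/
def DESB (w : List ℕ) : Set ℕ :=
  {x | ∃ (u v : List ℕ) (y : ℕ), w = u ++ y :: x :: v ∧ x < y}

/-! ### Di-sk trees -/

/-- The two labels `⊕` and `⊖`. -/
inductive Label where
  | oplus : Label
  | ominus : Label
  deriving DecidableEq

/-- The label of the root, if there is one. -/
def rootLabel : BinaryTree Label → Option Label
  | .nil => none
  | .node a _ _ => some a

/-- No node has the same label as its right child. -/
def IsDiSk : BinaryTree Label → Prop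
  | .nil => True
  | .node a l r => rootLabel r ≠ some a ∧ IsDiSk l ∧ IsDiSk r

/-- The set `𝔇𝔗ₙ` of di-sk trees with `n - 1` nodes (there are none for `n = 0`). -/
def DT (n : ℕ) : Type :=
  {T : BinaryTree Label // IsDiSk T ∧ T.numNodes + 1 = n}

/-- The labels of the nodes, in inorder: left subtree, node, right subtree. -/
def inorder : BinaryTree Label → List Label
  | .nil => []
  | .node a l r => inorder l ++ a :: inorder r

/-- The labels on the spine, from the top: the spine is the path from the root to the first node
in inorder, so it follows the left children as long as possible. -/
def spine : BinaryTree Label → List Label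
  | .nil => []
  | .node a l _ => a :: spine l

/-- The number of initial `⊕` in a list of labels. -/
def initialOplus (s : List Label) : ℕ :=
  (s.takeWhile (fun a => decide (a = Label.oplus))).length

/-- The number of initial `⊕`-nodes in inorder. -/
def iop (T : BinaryTree Label) : ℕ :=
  initialOplus (inorder T)

/-- The number of top consecutive `⊕`-nodes of the spine. -/
def top (T : BinaryTree Label) : ℕ :=
  initialOplus (spine T)

/-- Di-sk trees with `n - 1` nodes whose spine contains a `⊖`-node, and with `top = k`,
`iop = l`. -/
def DTtilde (n k l : ℕ) : Set (DT n) :=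
  {T | Label.ominus ∈ spine T.1 ∧ top T.1 = k ∧ iop T.1 = l}

/-! ### The map `η` from words to labelled trees -/

/-- All of the first `i` letters are larger than all of the remaining letters. -/
def SkewAt (w : List ℕ) (i : ℕ) : Prop :=
  ∀ x ∈ w.take i, ∀ y ∈ w.drop i, y < x

/-- All of the first `i` letters are smaller than all of the remaining letters. -/
def DirectAt (w : List ℕ) (i : ℕ) : Prop :=
  ∀ x ∈ w.take i, ∀ y ∈ w.drop i, x < y

instance (w : List ℕ) (i : ℕ) : Decidable (SkewAt w i) := by
  unfold SkewAt; infer_instance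

instance (w : List ℕ) (i : ℕ) : Decidable (DirectAt w i) := by
  unfold DirectAt; infer_instance

/-- The greatest index `i ∈ [n - 1]` at which `w = π₁ ⋯ πₙ` splits in one of the two ways
(and `0` if there is no such index). -/
def splitIndex (w : List ℕ) : ℕ :=
  Nat.findGreatest (fun i => 0 < i ∧ (SkewAt w i ∨ DirectAt w i)) (w.length - 1)

/-- The recursive decomposition of a word at its greatest splitting index. On separable
permutations this is the map `η`. -/
def etaWord (w : List ℕ) : BinaryTree Label :=
  if _h : 0 < splitIndex w ∧ splitIndex w < w.length then
    if SkewAt w (splitIndex w) then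
      .node Label.ominus
        (etaWord ((w.take (splitIndex w)).map (fun x => x - (w.length - splitIndex w))))
        (etaWord (w.drop (splitIndex w)))
    else
      .node Label.oplus
        (etaWord (w.take (splitIndex w)))
        (etaWord ((w.drop (splitIndex w)).map (fun x => x - splitIndex w)))
  else .nil
termination_by w.length
decreasing_by all_goals (simp; omega)

/-! ### The inverse of `η` -/

/-- Direct sum `u ⊕ v` of two permutations. -/
def directSum (u v : List ℕ) : List ℕ :=
  u ++ v.map (fun x => x + u.length)

/-- Skew sum `u ⊖ v` of two permutations. -/
def skewSum (u v : List ℕ) : List ℕ :=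
  u.map (fun x => x + v.length) ++ v

/-- Read a tree as an expression in `⊕` and `⊖`, each empty subtree being the permutation `1`. -/
def evalTree : BinaryTree Label → List ℕ
  | .nil => [1]
  | .node Label.oplus l r => directSum (evalTree l) (evalTree r)
  | .node Label.ominus l r => skewSum (evalTree l) (evalTree r)

/-! ### `evalTree` and `etaWord` are mutually inverse -/

theorem length_evalTree (T : BinaryTree Label) : (evalTree T).length = T.numNodes + 1 := by
  induction T with
  | nil => rfl
  | node a l r ihl ihr =>
    cases a <;> simp [evalTree, directSum, skewSum, BinaryTree.numNodes, ihl, ihr] <;> omega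

theorem isPerm_iff {n : ℕ} {w : List ℕ} :
    IsPerm n w ↔ w.length = n ∧ w.Nodup ∧ ∀ x ∈ w, 1 ≤ x ∧ x ≤ n := by
  constructor
  · intro h
    refine ⟨by simpa using h.length_eq, h.nodup_iff.mpr List.nodup_range', fun x hx => ?_⟩
    have := (h.mem_iff (a := x)).mp hx
    rw [List.mem_range'_1] at this
    omega
  · rintro ⟨hl, hn, hb⟩
    refine (List.subperm_of_subset hn ?_).perm_of_length_le (by simp [hl])
    intro x hx
    rw [List.mem_range'_1]
    have := hb x hx
    omega

theorem isPerm_directSum {m n : ℕ} {u v : List ℕ} (hu : IsPerm m u) (hv : IsPerm n v) :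
    IsPerm (m + n) (directSum u v) := by
  rw [isPerm_iff] at *
  obtain ⟨hu1, hu2, hu3⟩ := hu
  obtain ⟨hv1, hv2, hv3⟩ := hv
  refine ⟨by simp [directSum, hu1, hv1], ?_, ?_⟩
  · rw [directSum, List.nodup_append]
    refine ⟨hu2, hv2.map (fun a b h => by simpa using h), ?_⟩
    intro a ha b hb
    obtain ⟨c, hc, rfl⟩ := List.mem_map.mp hb
    have := hu3 a ha
    have := hv3 c hc
    omega
  · intro x hx
    rcases List.mem_append.mp hx with h | h
    · have := hu3 x h
      omega
    · obtain ⟨c, hc, rfl⟩ := List.mem_map.mp h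
      have := hv3 c hc
      omega

theorem isPerm_skewSum {m n : ℕ} {u v : List ℕ} (hu : IsPerm m u) (hv : IsPerm n v) :
    IsPerm (m + n) (skewSum u v) := by
  rw [isPerm_iff] at *
  obtain ⟨hu1, hu2, hu3⟩ := hu
  obtain ⟨hv1, hv2, hv3⟩ := hv
  refine ⟨by simp [skewSum, hu1, hv1], ?_, ?_⟩
  · rw [skewSum, List.nodup_append]
    refine ⟨hu2.map (fun a b h => by simpa using h), hv2, ?_⟩
    intro a ha b hb
    obtain ⟨c, hc, rfl⟩ := List.mem_map.mp ha
    have := hu3 c hc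
    have := hv3 b hb
    omega
  · intro x hx
    rcases List.mem_append.mp hx with h | h
    · obtain ⟨c, hc, rfl⟩ := List.mem_map.mp h
      have := hu3 c hc
      omega
    · have := hv3 x h
      omega

theorem isPerm_evalTree (T : BinaryTree Label) : IsPerm (T.numNodes + 1) (evalTree T) := by
  induction T with
  | nil => simp [IsPerm, evalTree, BinaryTree.numNodes]
  | node a l r ihl ihr =>
    cases a
    · have := isPerm_directSum ihl ihr
      rwa [show l.numNodes + 1 + (r.numNodes + 1) = l.numNodes + r.numNodes + 1 + 1 by omega]
        at this
    · have := isPerm_skewSum ihl ihr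
      rwa [show l.numNodes + 1 + (r.numNodes + 1) = l.numNodes + r.numNodes + 1 + 1 by omega]
        at this

theorem avoids_2413_iff {w : List ℕ} : Avoids w [2, 4, 1, 3] ↔
    ∀ a x y z, [a, x, y, z].Sublist w → ¬ (y < a ∧ a < z ∧ z < x) := by
  constructor
  · rintro h a x y z hs hlt
    refine h ⟨_, hs, rfl, ?_⟩
    intro i j
    fin_cases i <;> fin_cases j <;> simp <;> omega
  · rintro h ⟨u, hs, hl, ho⟩
    match u, hl, hs, ho with
    | [a, x, y, z], _, hs, ho =>
      refine h a x y z hs ⟨?_, ?_, ?_⟩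
      · simpa using ho 2 0
      · simpa using ho 0 3
      · simpa using ho 3 1

theorem avoids_3142_iff {w : List ℕ} : Avoids w [3, 1, 4, 2] ↔
    ∀ a x y z, [a, x, y, z].Sublist w → ¬ (x < z ∧ z < a ∧ a < y) := by
  constructor
  · rintro h a x y z hs hlt
    refine h ⟨_, hs, rfl, ?_⟩
    intro i j
    fin_cases i <;> fin_cases j <;> simp <;> omega
  · rintro h ⟨u, hs, hl, ho⟩
    match u, hl, hs, ho with
    | [a, x, y, z], _, hs, ho =>
      refine h a x y z hs ⟨?_, ?_, ?_⟩
      · simpa using ho 1 3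
      · simpa using ho 3 0
      · simpa using ho 0 2

theorem sublist_four_append {A B : List ℕ} {a x y z : ℕ} (h : [a, x, y, z].Sublist (A ++ B)) :
    [a, x, y, z].Sublist A ∨ [a, x, y, z].Sublist B ∨
      (a ∈ A ∧ x ∈ B ∧ y ∈ B ∧ z ∈ B) ∨ (a ∈ A ∧ x ∈ A ∧ y ∈ B ∧ z ∈ B) ∨
      (a ∈ A ∧ x ∈ A ∧ y ∈ A ∧ z ∈ B) := by
  obtain ⟨l₁, l₂, he, h₁, h₂⟩ := List.sublist_append_iff.mp h
  have s₁ := h₁.subset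
  have s₂ := h₂.subset
  match l₁, he with
  | [], he =>
    simp only [List.nil_append] at he
    subst he
    exact Or.inr (Or.inl h₂)
  | [b], he =>
    simp at he
    obtain ⟨rfl, rfl⟩ := he
    simp at s₁ s₂
    tauto
  | [b, c], he =>
    simp at he
    obtain ⟨rfl, rfl, rfl⟩ := he
    simp at s₁ s₂
    tauto
  | [b, c, d], he =>
    simp at he
    obtain ⟨rfl, rfl, rfl, rfl⟩ := he
    simp at s₁ s₂
    tauto
  | [b, c, d, e], he =>
    simp at he
    obtain ⟨rfl, rfl, rfl, rfl, rfl⟩ := he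
    exact Or.inl h₁
  | b :: c :: d :: e :: f :: t, he => simp at he

/-- Avoidance of `2413` and `3142`. -/
def Sep (w : List ℕ) : Prop :=
  Avoids w [2, 4, 1, 3] ∧ Avoids w [3, 1, 4, 2]

theorem sep_iff {w : List ℕ} : Sep w ↔ ∀ a x y z, [a, x, y, z].Sublist w →
    ¬ (y < a ∧ a < z ∧ z < x) ∧ ¬ (x < z ∧ z < a ∧ a < y) := by
  rw [Sep, avoids_2413_iff, avoids_3142_iff]
  exact ⟨fun h a x y z hs => ⟨h.1 a x y z hs, h.2 a x y z hs⟩,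
    fun h => ⟨fun a x y z hs => (h a x y z hs).1, fun a x y z hs => (h a x y z hs).2⟩⟩

theorem Sep.sublist {u w : List ℕ} (hw : Sep w) (h : u.Sublist w) : Sep u := by
  rw [sep_iff] at *
  exact fun a x y z hs => hw a x y z (hs.trans h)

theorem Sep.map {u : List ℕ} (hu : Sep u) (f : ℕ → ℕ)
    (hf : ∀ x ∈ u, ∀ y ∈ u, f x < f y → x < y) : Sep (u.map f) := by
  rw [sep_iff] at *
  intro a x y z hs
  obtain ⟨l, hl, he⟩ := List.sublist_map_iff.mp hs
  match l, he with
  | [a', x', y', z'], he =>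
    simp at he
    obtain ⟨rfl, rfl, rfl, rfl⟩ := he
    have s := hl.subset
    simp at s
    obtain ⟨ha, hx, hy, hz⟩ := s
    have := hu _ _ _ _ hl
    exact ⟨fun h => this.1 ⟨hf _ hy _ ha h.1, hf _ ha _ hz h.2.1, hf _ hz _ hx h.2.2⟩,
      fun h => this.2 ⟨hf _ hx _ hz h.1, hf _ hz _ ha h.2.1, hf _ ha _ hy h.2.2⟩⟩

theorem Sep.append {A B : List ℕ} (hA : Sep A) (hB : Sep B)
    (h : (∀ x ∈ A, ∀ y ∈ B, x < y) ∨ (∀ x ∈ A, ∀ y ∈ B, y < x)) : Sep (A ++ B) := by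
  rw [sep_iff] at *
  intro a x y z hs
  rcases sublist_four_append hs with hs | hs | ⟨ha, hx, hy, hz⟩ | ⟨ha, hx, hy, hz⟩ |
    ⟨ha, hx, hy, hz⟩
  · exact hA _ _ _ _ hs
  · exact hB _ _ _ _ hs
  · rcases h with h | h
    · have := h a ha x hx
      have := h a ha y hy
      have := h a ha z hz
      omega
    · have := h a ha x hx
      have := h a ha y hy
      have := h a ha z hz
      omega
  · rcases h with h | h
    · have := h a ha y hy
      have := h a ha z hz
      have := h x hx y hy
      have := h x hx z hz
      omega
    · have := h a ha y hy
      have := h a ha z hz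
      have := h x hx y hy
      have := h x hx z hz
      omega
  · rcases h with h | h
    · have := h a ha z hz
      have := h x hx z hz
      have := h y hy z hz
      omega
    · have := h a ha z hz
      have := h x hx z hz
      have := h y hy z hz
      omega

theorem directAt_directSum {m n : ℕ} {u v : List ℕ} (hu : IsPerm m u) (hv : IsPerm n v) :
    ∀ x ∈ u, ∀ y ∈ v.map (fun x => x + u.length), x < y := by
  rw [isPerm_iff] at *
  intro x hx y hy
  obtain ⟨c, hc, rfl⟩ := List.mem_map.mp hy
  have := hu.2.2 x hx
  have := hv.2.2 c hc
  omega

theorem skewAt_skewSum {m n : ℕ} {u v : List ℕ} (hu : IsPerm m u) (hv : IsPerm n v) :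
    ∀ x ∈ u.map (fun x => x + v.length), ∀ y ∈ v, y < x := by
  rw [isPerm_iff] at *
  intro y hy x hx
  obtain ⟨c, hc, rfl⟩ := List.mem_map.mp hy
  have := hv.2.2 x hx
  have := hu.2.2 c hc
  omega

theorem sep_evalTree (T : BinaryTree Label) : Sep (evalTree T) := by
  induction T with
  | nil =>
    rw [sep_iff]
    intro a x y z hs
    have := hs.length_le
    simp [evalTree] at this
  | node a l r ihl ihr =>
    cases a
    · exact ihl.append (ihr.map _ (by intros; omega))
        (Or.inl (directAt_directSum (isPerm_evalTree l) (isPerm_evalTree r)))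
    · exact (ihl.map _ (by intros; omega)).append ihr
        (Or.inr (skewAt_skewSum (isPerm_evalTree l) (isPerm_evalTree r)))

/-! The splitting indices. -/

theorem not_skewAt_of_directAt {w : List ℕ} {i j : ℕ} (hi : 0 < i) (hi' : i < w.length)
    (hj : 0 < j) (hj' : j < w.length) (hd : DirectAt w i) (hs : SkewAt w j) : False := by
  have hw : 0 < w.length := by omega
  have first : ∀ k, 0 < k → w[0] ∈ w.take k := fun k hk =>
    List.mem_take_iff_getElem.mpr ⟨0, by omega, rfl⟩
  have last : ∀ k, k < w.length → w[w.length - 1] ∈ w.drop k := fun k hk =>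
    List.mem_drop_iff_getElem.mpr ⟨w.length - 1 - k, by omega, by congr 1; omega⟩
  have h₁ := hd _ (first i hi) _ (last i hi')
  have h₂ := hs _ (first j hj) _ (last j hj')
  omega

theorem splitIndex_eq {w : List ℕ} {s : ℕ} (h0 : 0 < s) (h1 : s < w.length)
    (h : SkewAt w s ∨ DirectAt w s)
    (hmax : ∀ j, s < j → j < w.length → ¬ (SkewAt w j ∨ DirectAt w j)) : splitIndex w = s := by
  rw [splitIndex, Nat.findGreatest_eq_iff]
  refine ⟨by omega, fun _ => ⟨h0, h⟩, fun j hj hj' hh => ?_⟩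
  exact hmax j hj (by omega) hh.2

theorem splitIndex_spec {w : List ℕ} (h0 : 0 < splitIndex w) :
    SkewAt w (splitIndex w) ∨ DirectAt w (splitIndex w) :=
  (Nat.findGreatest_of_ne_zero (rfl : splitIndex w = splitIndex w) (by omega)).2

theorem splitIndex_max {w : List ℕ} {j : ℕ} (h : splitIndex w < j) (hj : j < w.length) :
    ¬ (SkewAt w j ∨ DirectAt w j) := fun hh =>
  Nat.findGreatest_is_greatest h (by omega) ⟨by omega, hh⟩

theorem splitIndex_le (w : List ℕ) : splitIndex w ≤ w.length - 1 :=
  Nat.findGreatest_le _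

/-- Splitting the second part of a sum refines the splitting of the sum. -/
theorem directAt_append {A B : List ℕ} {j : ℕ} (h : ∀ x ∈ A, ∀ y ∈ B, x < y) :
    DirectAt (A ++ B) (A.length + j) ↔ DirectAt B j := by
  simp only [DirectAt, List.take_length_add_append, List.drop_length_add_append]
  constructor
  · exact fun H x hx y hy => H x (List.mem_append_right _ hx) y hy
  · intro H x hx y hy
    rcases List.mem_append.mp hx with hx | hx
    · exact h x hx y (List.mem_of_mem_drop hy)
    · exact H x hx y hy

theorem skewAt_append {A B : List ℕ} {j : ℕ} (h : ∀ x ∈ A, ∀ y ∈ B, y < x) :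
    SkewAt (A ++ B) (A.length + j) ↔ SkewAt B j := by
  simp only [SkewAt, List.take_length_add_append, List.drop_length_add_append]
  constructor
  · exact fun H x hx y hy => H x (List.mem_append_right _ hx) y hy
  · intro H x hx y hy
    rcases List.mem_append.mp hx with hx | hx
    · exact h x hx y (List.mem_of_mem_drop hy)
    · exact H x hx y hy

theorem directAt_map_add {B : List ℕ} {c j : ℕ} :
    DirectAt (B.map (fun x => x + c)) j ↔ DirectAt B j := by
  simp [DirectAt, ← List.map_take, ← List.map_drop]

theorem evalTree_split (a : Label) (l r : BinaryTree Label) :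
    if a = Label.oplus then DirectAt (evalTree (.node a l r)) (evalTree l).length
    else SkewAt (evalTree (.node a l r)) (evalTree l).length := by
  cases a
  · simpa [evalTree, directSum, DirectAt] using
      directAt_directSum (isPerm_evalTree l) (isPerm_evalTree r)
  · have := skewAt_skewSum (isPerm_evalTree l) (isPerm_evalTree r)
    have e : (evalTree l).length =
      ((evalTree l).map (fun x => x + (evalTree r).length)).length := by simp
    simp only [reduceCtorEq, if_false, evalTree, skewSum, SkewAt]
    rw [e, List.take_left, List.drop_left]
    exact this

theorem not_directAt_evalTree {T : BinaryTree Label} (h : rootLabel T ≠ some Label.oplus) {j : ℕ}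
    (hj : 0 < j) (hj' : j < (evalTree T).length) : ¬ DirectAt (evalTree T) j := by
  match T, h with
  | .nil, _ => simp [evalTree] at hj'; omega
  | .node Label.oplus l r, h => simp [rootLabel] at h
  | .node Label.ominus l r, _ =>
    intro hd
    have hs := evalTree_split Label.ominus l r
    simp only [reduceCtorEq, if_false] at hs
    refine not_skewAt_of_directAt hj hj' ?_ ?_ hd hs <;>
      simp [length_evalTree, BinaryTree.numNodes]

theorem not_skewAt_evalTree {T : BinaryTree Label} (h : rootLabel T ≠ some Label.ominus) {j : ℕ}
    (hj : 0 < j) (hj' : j < (evalTree T).length) : ¬ SkewAt (evalTree T) j := by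
  match T, h with
  | .nil, _ => simp [evalTree] at hj'; omega
  | .node Label.ominus l r, h => simp [rootLabel] at h
  | .node Label.oplus l r, _ =>
    intro hd
    have hs := evalTree_split Label.oplus l r
    simp only [if_true] at hs
    refine not_skewAt_of_directAt ?_ ?_ hj hj' hs hd <;>
      simp [length_evalTree, BinaryTree.numNodes]

theorem splitIndex_evalTree {a : Label} {l r : BinaryTree Label} (h : rootLabel r ≠ some a) :
    splitIndex (evalTree (.node a l r)) = (evalTree l).length := by
  have hs := evalTree_split a l r
  have hl : (evalTree (.node a l r)).length = (evalTree l).length + (evalTree r).length := by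
    simp [length_evalTree, BinaryTree.numNodes]; omega
  have pl := length_evalTree l
  have pr := length_evalTree r
  cases a
  · simp only [if_true] at hs
    refine splitIndex_eq (by omega) (by omega) (Or.inr hs) fun j hj hj' => ?_
    rintro (H | H)
    · exact not_skewAt_of_directAt (by omega) (by omega) (by omega) hj' hs H
    · obtain ⟨i, rfl⟩ := Nat.exists_eq_add_of_lt hj
      rw [evalTree, directSum, add_assoc,
        directAt_append (directAt_directSum (isPerm_evalTree l) (isPerm_evalTree r)),
        directAt_map_add] at H
      exact not_directAt_evalTree h (by omega) (by omega) H
  · simp only [reduceCtorEq, if_false] at hs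
    refine splitIndex_eq (by omega) (by omega) (Or.inl hs) fun j hj hj' => ?_
    rintro (H | H)
    · obtain ⟨i, rfl⟩ := Nat.exists_eq_add_of_lt hj
      have e : (evalTree l).length =
        ((evalTree l).map (fun x => x + (evalTree r).length)).length := by simp
      rw [evalTree, skewSum, add_assoc, e,
        skewAt_append (skewAt_skewSum (isPerm_evalTree l) (isPerm_evalTree r))] at H
      exact not_skewAt_evalTree h (by omega) (by omega) H
    · exact not_skewAt_of_directAt (by omega) hj' (by omega) (by omega) H hs

theorem etaWord_evalTree {T : BinaryTree Label} (hT : IsDiSk T) : etaWord (evalTree T) = T := by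
  induction T with
  | nil =>
    rw [etaWord]
    simp [evalTree, splitIndex]
  | node a l r ihl ihr =>
    obtain ⟨h, hl, hr⟩ := hT
    have hsi := splitIndex_evalTree (l := l) h
    have hs := evalTree_split a l r
    have hlen : (evalTree (.node a l r)).length = (evalTree l).length + (evalTree r).length := by
      simp [length_evalTree, BinaryTree.numNodes]; omega
    have pl := length_evalTree l
    have pr := length_evalTree r
    rw [etaWord, dif_pos (by rw [hsi]; omega), hsi]
    cases a
    · simp only [if_true] at hs
      rw [if_neg (fun H => not_skewAt_of_directAt (by omega) (by omega) (by omega) (by omega) hs H)]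
      simp [evalTree, directSum, ihl hl, ihr hr, Function.comp_def]
    · simp only [reduceCtorEq, if_false] at hs
      rw [if_pos hs, hlen]
      have e : (evalTree l).length =
        ((evalTree l).map (fun x => x + (evalTree r).length)).length := by simp
      rw [evalTree, skewSum, Nat.add_sub_cancel_left]
      rw [e, List.take_left, List.drop_left, ihr hr, List.map_map]
      simp [ihl hl, Function.comp_def]

/-! Every separable permutation of length at least `2` splits. -/

theorem exists_split_cons {α : Type*} [LinearOrder α] {a : α} {A B : List α} (hA : A ≠ [])
    (hB : B ≠ []) (hn : a ∉ A ++ B) (h : ∀ x ∈ A, ∀ y ∈ B, x < y)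
    (hav : ∀ x y z, [x, y, z].Sublist (A ++ B) → ¬ (x < z ∧ z < a ∧ a < y)) :
    ∃ C D, a :: (A ++ B) = C ++ D ∧ C ≠ [] ∧ D ≠ [] ∧
      ((∀ x ∈ C, ∀ y ∈ D, x < y) ∨ (∀ x ∈ C, ∀ y ∈ D, y < x)) := by
  by_cases h1 : ∀ y ∈ B, a < y
  · refine ⟨a :: A, B, by simp, by simp, hB, Or.inl fun x hx y hy => ?_⟩
    rcases List.mem_cons.mp hx with rfl | hx
    · exact h1 y hy
    · exact h x hx y hy
  push Not at h1
  obtain ⟨z, hz, hza⟩ := h1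
  have hza : z < a := lt_of_le_of_ne hza fun e => hn (by rw [← e]; simp [hz])
  by_cases h2 : ∀ y ∈ B, y < a
  · refine ⟨[a], A ++ B, by simp, by simp, by simp [hA], Or.inr fun x hx y hy => ?_⟩
    obtain rfl := List.mem_singleton.mp hx
    rcases List.mem_append.mp hy with hy | hy
    · exact (h y hy z hz).trans hza
    · exact h2 y hy
  push Not at h2
  obtain ⟨y₀, hy₀, hay₀⟩ := h2
  have hsplit := List.takeWhile_append_dropWhile (p := fun y => decide (y < a)) (l := B)
  have htake : ∀ y ∈ B.takeWhile (fun y => decide (y < a)), y < a := fun y hy => by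
    simpa using List.mem_takeWhile_imp hy
  have hne : B.dropWhile (fun y => decide (y < a)) ≠ [] := by
    intro e
    rw [e, List.append_nil] at hsplit
    rw [← hsplit] at hy₀
    exact absurd (htake y₀ hy₀) (not_lt.mpr hay₀)
  have hdrop : ∀ y ∈ B.dropWhile (fun y => decide (y < a)), a < y := by
    obtain ⟨c, t, hc⟩ := List.exists_cons_of_ne_nil hne
    have hcB : ∀ y ∈ c :: t, y ∈ B := fun y hy => by
      rw [← hsplit, hc]; exact List.mem_append_right _ hy
    have hca : a < c := by
      have := List.head_dropWhile_not (fun y => decide (y < a)) hne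
      simp only [hc, List.head_cons, decide_eq_false_iff_not, not_lt] at this
      exact lt_of_le_of_ne this fun e => hn (by rw [e]; simp [hcB c (by simp)])
    rw [hc]
    intro y hy
    rcases List.mem_cons.mp hy with rfl | hy'
    · exact hca
    by_contra hya
    have hya : y < a := lt_of_le_of_ne (not_lt.mp hya) fun e =>
      hn (by rw [← e]; simp [hcB y hy])
    obtain ⟨x, hx⟩ := List.exists_mem_of_ne_nil A hA
    refine hav x c y ?_ ⟨h x hx y (hcB y hy), hya, hca⟩
    rw [← hsplit, hc]
    refine List.Sublist.append (List.singleton_sublist.mpr hx) (l₁ := [x]) ?_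
    refine List.Sublist.trans ?_ (List.sublist_append_right _ _)
    exact List.Sublist.cons_cons _ (List.singleton_sublist.mpr hy')
  refine ⟨a :: (A ++ B.takeWhile (fun y => decide (y < a))),
    B.dropWhile (fun y => decide (y < a)), ?_, by simp, hne, Or.inl fun x hx y hy => ?_⟩
  · simp [hsplit]
  · have hyB : y ∈ B := by rw [← hsplit]; exact List.mem_append_right _ hy
    rcases List.mem_cons.mp hx with rfl | hx
    · exact hdrop y hy
    rcases List.mem_append.mp hx with hx | hx
    · exact h x hx y hyB
    · exact (htake x hx).trans (hdrop y hy)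

theorem exists_split {w : List ℕ} (hn : w.Nodup) (hw : Sep w) (hl : 2 ≤ w.length) :
    ∃ C D, w = C ++ D ∧ C ≠ [] ∧ D ≠ [] ∧
      ((∀ x ∈ C, ∀ y ∈ D, x < y) ∨ (∀ x ∈ C, ∀ y ∈ D, y < x)) := by
  induction w with
  | nil => simp at hl
  | cons a w ih =>
    have hs := sep_iff.mp hw
    obtain ⟨ha, hn'⟩ := List.nodup_cons.mp hn
    by_cases hl' : 2 ≤ w.length
    · obtain ⟨A, B, rfl, hA, hB, h | h⟩ := ih hn' (hw.sublist (List.sublist_cons_self _ _)) hl'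
      · exact exists_split_cons hA hB ha h fun x y z hxyz =>
          (hs a x y z (List.Sublist.cons_cons _ hxyz)).2
      · obtain ⟨C, D, h₁, h₂, h₃, h₄⟩ := exists_split_cons (α := ℕᵒᵈ) (a := a) hA hB ha h
          fun x y z hxyz hlt =>
            (hs a x y z (List.Sublist.cons_cons _ hxyz)).1 ⟨hlt.2.2, hlt.2.1, hlt.1⟩
        exact ⟨C, D, h₁, h₂, h₃, h₄.symm⟩
    · match w, hl, hl', ha with
      | [b], _, _, ha =>
        refine ⟨[a], [b], rfl, by simp, by simp, ?_⟩
        simp at ha ⊢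
        omega
      | [], hl, _, _ => simp at hl
      | b :: c :: t, _, hl', _ => simp at hl'

theorem splitIndex_pos {w : List ℕ} (hn : w.Nodup) (hw : Sep w) (hl : 2 ≤ w.length) :
    0 < splitIndex w := by
  obtain ⟨C, D, rfl, hC, hD, h⟩ := exists_split hn hw hl
  have hC' := List.length_pos_iff.mpr hC
  have hD' := List.length_pos_iff.mpr hD
  by_contra h0
  refine splitIndex_max (w := C ++ D) (j := C.length) (by omega) (by simp; omega) ?_
  simpa [SkewAt, DirectAt] using h.symm

/-! The two parts of a splitting of a permutation. -/

theorem bounds_of_append {n : ℕ} {A B : List ℕ} (hp : IsPerm n (A ++ B)) :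
    ((∀ x ∈ A, ∀ y ∈ B, x < y) → (∀ x ∈ A, x ≤ A.length) ∧ ∀ y ∈ B, A.length < y) ∧
    ((∀ x ∈ A, ∀ y ∈ B, y < x) → (∀ x ∈ A, B.length < x) ∧ ∀ y ∈ B, y ≤ B.length) := by
  have mem : ∀ x, 1 ≤ x → x ≤ n → x ∈ A ∨ x ∈ B := fun x h1 h2 => by
    rw [← List.mem_append, hp.mem_iff, List.mem_range'_1]; omega
  obtain ⟨hl, hn, hb⟩ := isPerm_iff.mp hp
  rw [List.length_append] at hl
  have hbA : ∀ x ∈ A, 1 ≤ x ∧ x ≤ n := fun x hx => hb x (List.mem_append_left _ hx)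
  have hbB : ∀ x ∈ B, 1 ≤ x ∧ x ≤ n := fun x hx => hb x (List.mem_append_right _ hx)
  have card : ∀ (L : List ℕ) (p q : ℕ), (∀ x, p ≤ x → x ≤ q → x ∈ L) → q + 1 - p ≤ L.length := by
    intro L p q h
    rw [← Nat.card_Icc]
    refine le_trans (Finset.card_le_card (t := L.toFinset) ?_) (List.toFinset_card_le L)
    intro x hx
    rw [Finset.mem_Icc] at hx
    exact List.mem_toFinset.mpr (h x hx.1 hx.2)
  refine ⟨fun h => ⟨fun x hx => ?_, fun y hy => ?_⟩, fun h => ⟨fun x hx => ?_, fun y hy => ?_⟩⟩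
  · have := card A 1 x fun t h1 h2 => (mem t h1 (h2.trans (hbA x hx).2)).resolve_right
      fun ht => absurd (h x hx t ht) (by omega)
    omega
  · have := card B y n fun t h1 h2 => (mem t ((hbB y hy).1.trans h1) h2).resolve_left
      fun ht => absurd (h t ht y hy) (by omega)
    have := hbB y hy
    omega
  · have := card A x n fun t h1 h2 => (mem t ((hbA x hx).1.trans h1) h2).resolve_right
      fun ht => absurd (h x hx t ht) (by omega)
    have := hbA x hx
    omega
  · have := card B 1 y fun t h1 h2 => (mem t h1 (h2.trans (hbB y hy).2)).resolve_left
      fun ht => absurd (h t ht y hy) (by omega)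
    omega

theorem isPerm_parts_direct {n : ℕ} {A B : List ℕ} (hp : IsPerm n (A ++ B))
    (h : ∀ x ∈ A, ∀ y ∈ B, x < y) :
    IsPerm A.length A ∧ IsPerm B.length (B.map (fun x => x - A.length)) ∧
      directSum A (B.map (fun x => x - A.length)) = A ++ B := by
  obtain ⟨hA, hB⟩ := (bounds_of_append hp).1 h
  obtain ⟨hl, hn, hb⟩ := isPerm_iff.mp hp
  rw [List.length_append] at hl
  obtain ⟨hnA, hnB, -⟩ := List.nodup_append.mp hn
  refine ⟨isPerm_iff.mpr ⟨rfl, hnA, fun x hx => ⟨(hb x (by simp [hx])).1, hA x hx⟩⟩,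
    isPerm_iff.mpr ⟨by simp, ?_, ?_⟩, ?_⟩
  · refine List.Nodup.map_on (fun x hx y hy hxy => ?_) hnB
    have := hB x hx
    have := hB y hy
    omega
  · intro x hx
    obtain ⟨y, hy, rfl⟩ := List.mem_map.mp hx
    have := hB y hy
    have := hb y (by simp [hy])
    omega
  · rw [directSum, List.map_map]
    congr 1
    conv_rhs => rw [← List.map_id B]
    refine List.map_congr_left fun x hx => ?_
    have := hB x hx
    simp only [Function.comp_apply, id_eq]
    omega

theorem isPerm_parts_skew {n : ℕ} {A B : List ℕ} (hp : IsPerm n (A ++ B))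
    (h : ∀ x ∈ A, ∀ y ∈ B, y < x) :
    IsPerm A.length (A.map (fun x => x - B.length)) ∧ IsPerm B.length B ∧
      skewSum (A.map (fun x => x - B.length)) B = A ++ B := by
  obtain ⟨hA, hB⟩ := (bounds_of_append hp).2 h
  obtain ⟨hl, hn, hb⟩ := isPerm_iff.mp hp
  rw [List.length_append] at hl
  obtain ⟨hnA, hnB, -⟩ := List.nodup_append.mp hn
  refine ⟨isPerm_iff.mpr ⟨by simp, ?_, ?_⟩,
    isPerm_iff.mpr ⟨rfl, hnB, fun x hx => ⟨(hb x (by simp [hx])).1, hB x hx⟩⟩, ?_⟩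
  · refine List.Nodup.map_on (fun x hx y hy hxy => ?_) hnA
    have := hA x hx
    have := hA y hy
    omega
  · intro x hx
    obtain ⟨y, hy, rfl⟩ := List.mem_map.mp hx
    have := hA y hy
    have := hb y (by simp [hy])
    omega
  · rw [skewSum, List.map_map]
    congr 1
    conv_rhs => rw [← List.map_id A]
    refine List.map_congr_left fun x hx => ?_
    have := hA x hx
    simp only [Function.comp_apply, id_eq]
    omega

theorem directAt_of_rootLabel {w : List ℕ} (h : rootLabel (etaWord w) = some Label.oplus) :
    ∃ j, 0 < j ∧ j < w.length ∧ DirectAt w j := by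
  rw [etaWord] at h
  split_ifs at h with h1 h2
  · simp [rootLabel] at h
  · exact ⟨_, h1.1, h1.2, (splitIndex_spec h1.1).resolve_left h2⟩
  · simp [rootLabel] at h

theorem skewAt_of_rootLabel {w : List ℕ} (h : rootLabel (etaWord w) = some Label.ominus) :
    ∃ j, 0 < j ∧ j < w.length ∧ SkewAt w j := by
  rw [etaWord] at h
  split_ifs at h with h1 h2
  · exact ⟨_, h1.1, h1.2, h2⟩
  · simp [rootLabel] at h
  · simp [rootLabel] at h

theorem evalTree_etaWord {n : ℕ} (hn : 1 ≤ n) {w : List ℕ} (hp : IsPerm n w) (hw : Sep w) :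
    IsDiSk (etaWord w) ∧ evalTree (etaWord w) = w := by
  induction n using Nat.strong_induction_on generalizing w with
  | _ n ih =>
    obtain ⟨hl, hnd, hb⟩ := isPerm_iff.mp hp
    have hle := splitIndex_le w
    by_cases h2 : 2 ≤ w.length
    · have h0 := splitIndex_pos hnd hw h2
      have hspec := splitIndex_spec h0
      have hmax := @splitIndex_max w
      have hsepA := hw.sublist (List.take_sublist (splitIndex w) w)
      have hsepB := hw.sublist (List.drop_sublist (splitIndex w) w)
      have hAB := List.take_append_drop (splitIndex w) w
      have hlA : (w.take (splitIndex w)).length = splitIndex w := by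
        rw [List.length_take]; omega
      have hlB : (w.drop (splitIndex w)).length = w.length - splitIndex w := List.length_drop
      rw [etaWord, dif_pos ⟨h0, by omega⟩]
      split_ifs with hs
      · rw [← hlB]
        unfold SkewAt at hs
        generalize w.take (splitIndex w) = A at *
        generalize w.drop (splitIndex w) = B at *
        rw [← hAB] at hp
        obtain ⟨pA, pB, e⟩ := isPerm_parts_skew hp hs
        have hbA := ((bounds_of_append hp).2 hs).1
        obtain ⟨dA, eA⟩ := ih A.length (by omega) (by omega) pA
          (hsepA.map _ fun x hx y hy hxy => by have := hbA x hx; omega)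
        obtain ⟨dB, eB⟩ := ih B.length (by omega) (by omega) pB hsepB
        refine ⟨⟨fun hr => ?_, dA, dB⟩, by rw [evalTree, eA, eB, e, hAB]⟩
        obtain ⟨j, hj, hj', hd⟩ := skewAt_of_rootLabel hr
        refine hmax (j := A.length + j) (by omega) (by omega) (Or.inl ?_)
        rw [← hAB, skewAt_append hs]
        exact hd
      · replace hs := hspec.resolve_left hs
        unfold DirectAt at hs
        generalize w.take (splitIndex w) = A at *
        generalize w.drop (splitIndex w) = B at *
        rw [← hlA]
        rw [← hAB] at hp
        obtain ⟨pA, pB, e⟩ := isPerm_parts_direct hp hs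
        have hbB := ((bounds_of_append hp).1 hs).2
        obtain ⟨dA, eA⟩ := ih A.length (by omega) (by omega) pA hsepA
        obtain ⟨dB, eB⟩ := ih B.length (by omega) (by omega) pB
          (hsepB.map _ fun x hx y hy hxy => by have := hbB x hx; omega)
        refine ⟨⟨fun hr => ?_, dA, dB⟩, by rw [evalTree, eA, eB, e, hAB]⟩
        obtain ⟨j, hj, hj', hd⟩ := directAt_of_rootLabel hr
        rw [List.length_map] at hj'
        refine hmax (j := A.length + j) (by omega) (by omega) (Or.inr ?_)
        rw [← hAB, directAt_append hs]
        intro x hx y hy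
        have hx' := hbB x (List.mem_of_mem_take hx)
        have hy' := hbB y (List.mem_of_mem_drop hy)
        have := hd (x - A.length) (by rw [← List.map_take]; exact List.mem_map_of_mem hx)
          (y - A.length) (by rw [← List.map_drop]; exact List.mem_map_of_mem hy)
        omega
    · rw [etaWord, dif_neg (by omega)]
      refine ⟨trivial, ?_⟩
      match w, hl, h2, hb with
      | [], hl, _, _ => simp at hl; omega
      | [x], hl, _, hb =>
        simp at hl
        have := hb x (by simp)
        rw [evalTree]
        congr 1
        omega
      | _ :: _ :: _, _, h2, _ => simp at h2

/-! ### The bijection `η` -/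

/-- The bijection `η` from the separable permutations of `[n]` onto the di-sk trees with
`n - 1` nodes. -/
def eta (n : ℕ) (hn : 1 ≤ n) : SepPerm n ≃ DT n where
  toFun w := ⟨etaWord w.1, (evalTree_etaWord hn w.2.1 w.2.2).1, by
    rw [← length_evalTree, (evalTree_etaWord hn w.2.1 w.2.2).2, (isPerm_iff.mp w.2.1).1]⟩
  invFun T := ⟨evalTree T.1, by
    have := isPerm_evalTree T.1
    rwa [T.2.2] at this, sep_evalTree T.1⟩
  left_inv w := Subtype.ext (evalTree_etaWord hn w.2.1 w.2.2).2
  right_inv T := Subtype.ext (etaWord_evalTree T.2.1)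

end DiSk

/-!
The bijection moves one unit from `top` to `iop`, at constant `top + iop`. It comes from a family of
maps `retarget` that set `iop` to any prescribed value `l ≤ top + iop`.

Read the spine from its bottom. Each spine node, together with its right subtree, is a block that is
added above (`⊕`) or below (`⊖`) the permutation built so far. An upper block does not see whether a
lower one comes before or after it, so `(A ⊕ B) ⊖ C` and `(A ⊖ C) ⊕ B` have the same `DESB`, `LMAX`
and `LMIN` (`SameStats.ominus_oplus_comm`). Hence these sets depend only on the sequence of the
`⊕`-blocks and on that of the `⊖`-blocks, not on how the two are interleaved
(`SameStats.extend_fill`). Moreover, by associativity of `⊕`, consecutive `⊕`-blocks may be replaced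
by others with the same direct sum up to the statistics (`SameStats.extend_summands`).

Let `c` be the number of `⊕`-nodes below the lowest `⊖` of the spine. The sequence of `⊕`-blocks
begins with some number `j` of single letters. If there are other blocks, the next one has root `⊖`;
let `C` be the direct sum of it and all later blocks, a smaller tree that again has a `⊖` on its
spine. Then `iop` is `c` if `c ≤ j`, and `j + 1 + iop C` otherwise. In either case there is one
parameter that `iop` does not see: `iop C` in the first case, `c - j - 1` in the second
(`hiddenOplus`). Keeping this hidden parameter `e` and the part of the spine between its lowest and
highest `⊖`, while prescribing `iop = f`, leads to `c = f` and `iop C = e` if `f ≤ j`, and to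
`c = e + j + 1` and `iop C = f - j - 1` otherwise (`normalForm`). The change of `iop C` is made by
recursion, and the condition that the spine has enough `⊕`-nodes for this is the same inequality in
both cases, namely that `top` remains nonnegative (`normalForm_eq_assemble`). Since `e` is not
changed, prescribing `iop` twice has the effect of the second prescription alone, which makes the
maps invertible (`retargets_assemble`). If all `⊕`-blocks are single letters, it is enough to move
`⊕`-nodes between the two ends of the spine (`retargets_assemble_replicate`).
-/

namespace DiSk

/-! ### Left-to-right extrema and descent bottoms of sums -/

theorem LMAX_directSum {m n : ℕ} {u v : List ℕ} (hu : IsPerm m u) (hv : IsPerm n v) :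
    LMAX (directSum u v) = LMAX u ∪ (· + u.length) '' LMAX v := by
  have hlt := directAt_directSum hu hv
  ext x
  constructor
  · rintro ⟨p, q, h, hp⟩
    rcases List.append_eq_append_iff.mp h with ⟨a', h₁, h₂⟩ | ⟨a', h₁, h₂⟩
    · obtain ⟨v₁, v₂, rfl, rfl, hv₂⟩ := List.map_eq_append_iff.mp h₂
      obtain ⟨y, v₃, rfl, rfl, rfl⟩ := List.map_eq_cons_iff.mp hv₂
      refine Or.inr ⟨y, ⟨v₁, v₃, rfl, fun z hz => ?_⟩, rfl⟩
      have := hp (z + u.length) (by rw [h₁]; simp [hz])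
      omega
    · rcases a' with _ | ⟨b, a'⟩
      · simp only [List.nil_append] at h₂
        obtain ⟨y, v₃, rfl, rfl, rfl⟩ := List.map_eq_cons_iff.mp h₂.symm
        exact Or.inr ⟨y, ⟨[], v₃, rfl, by simp⟩, rfl⟩
      · simp only [List.cons_append, List.cons.injEq] at h₂
        obtain ⟨rfl, rfl⟩ := h₂
        exact Or.inl ⟨p, a', h₁, hp⟩
  · rintro (⟨p, q, rfl, hp⟩ | ⟨y, ⟨p, q, rfl, hp⟩, rfl⟩)
    · exact ⟨p, q ++ v.map (fun x => x + (p ++ x :: q).length), by simp [directSum], hp⟩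
    · refine ⟨u ++ p.map (fun x => x + u.length), q.map (fun x => x + u.length),
        by simp [directSum], fun z hz => ?_⟩
      rcases List.mem_append.mp hz with hz | hz
      · exact hlt z hz _ (by simp)
      · obtain ⟨c, hc, rfl⟩ := List.mem_map.mp hz
        have := hp c hc
        dsimp only
        omega

theorem LMIN_skewSum {m n : ℕ} {u v : List ℕ} (hu : IsPerm m u) (hv : IsPerm n v) :
    LMIN (skewSum u v) = (· + v.length) '' LMIN u ∪ LMIN v := by
  have hlt := skewAt_skewSum hu hv
  ext x
  constructor
  · rintro ⟨p, q, h, hp⟩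
    rcases List.append_eq_append_iff.mp h with ⟨a', h₁, h₂⟩ | ⟨a', h₁, h₂⟩
    · exact Or.inr ⟨a', q, h₂, fun z hz => hp z (by rw [h₁]; simp [hz])⟩
    · rcases a' with _ | ⟨b, a'⟩
      · exact Or.inr ⟨[], q, by simpa using h₂.symm, by simp⟩
      · simp only [List.cons_append, List.cons.injEq] at h₂
        obtain ⟨rfl, rfl⟩ := h₂
        obtain ⟨u₁, u₂, rfl, rfl, hu₂⟩ := List.map_eq_append_iff.mp h₁
        obtain ⟨y, u₃, rfl, rfl, rfl⟩ := List.map_eq_cons_iff.mp hu₂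
        refine Or.inl ⟨y, ⟨u₁, u₃, rfl, fun z hz => ?_⟩, rfl⟩
        have := hp (z + v.length) (by simp [hz])
        omega
  · rintro (⟨y, ⟨p, q, rfl, hp⟩, rfl⟩ | ⟨p, q, rfl, hp⟩)
    · refine ⟨p.map (fun x => x + v.length), q.map (fun x => x + v.length) ++ v,
        by simp [skewSum], fun z hz => ?_⟩
      obtain ⟨c, hc, rfl⟩ := List.mem_map.mp hz
      have := hp c hc
      dsimp only
      omega
    · refine ⟨u.map (fun y => y + (p ++ x :: q).length) ++ p, q, by simp [skewSum], fun z hz => ?_⟩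
      rcases List.mem_append.mp hz with hz | hz
      · exact hlt z hz _ (by simp)
      · exact hp z hz

theorem LMIN_directSum {m n : ℕ} {u v : List ℕ} (hu : IsPerm m u) (hv : IsPerm n v)
    (h0 : u ≠ []) : LMIN (directSum u v) = LMIN u := by
  have hlt := directAt_directSum hu hv
  ext x
  constructor
  · rintro ⟨p, q, h, hp⟩
    rcases List.append_eq_append_iff.mp h with ⟨a', h₁, h₂⟩ | ⟨a', h₁, h₂⟩
    · obtain ⟨b, hb⟩ := List.exists_mem_of_ne_nil u h0
      have := hlt b hb x (by rw [h₂]; simp)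
      have := hp b (by rw [h₁]; simp [hb])
      omega
    · rcases a' with _ | ⟨b, a'⟩
      · obtain ⟨b, hb⟩ := List.exists_mem_of_ne_nil u h0
        have := hlt b hb x (by simp only [List.nil_append] at h₂; rw [← h₂]; simp)
        have := hp b (by rw [h₁] at hb; simpa using hb)
        omega
      · simp only [List.cons_append, List.cons.injEq] at h₂
        obtain ⟨rfl, rfl⟩ := h₂
        exact ⟨p, a', h₁, hp⟩
  · rintro ⟨p, q, rfl, hp⟩
    exact ⟨p, q ++ v.map (fun y => y + (p ++ x :: q).length), by simp [directSum], hp⟩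

theorem LMAX_skewSum {m n : ℕ} {u v : List ℕ} (hu : IsPerm m u) (hv : IsPerm n v)
    (h0 : u ≠ []) : LMAX (skewSum u v) = (· + v.length) '' LMAX u := by
  have hlt := skewAt_skewSum hu hv
  obtain ⟨b, hb⟩ := List.exists_mem_of_ne_nil u h0
  have hb' : b + v.length ∈ u.map (fun x => x + v.length) := List.mem_map_of_mem hb
  ext x
  constructor
  · rintro ⟨p, q, h, hp⟩
    rcases List.append_eq_append_iff.mp h with ⟨a', h₁, h₂⟩ | ⟨a', h₁, h₂⟩
    · have := hlt _ hb' x (by rw [h₂]; simp)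
      have := hp (b + v.length) (by rw [h₁]; exact List.mem_append_left _ hb')
      omega
    · rcases a' with _ | ⟨d, a'⟩
      · have := hlt _ hb' x (by simp only [List.nil_append] at h₂; rw [← h₂]; simp)
        have := hp (b + v.length) (by rw [h₁] at hb'; simpa using hb')
        omega
      · simp only [List.cons_append, List.cons.injEq] at h₂
        obtain ⟨rfl, rfl⟩ := h₂
        obtain ⟨u₁, u₂, rfl, rfl, hu₂⟩ := List.map_eq_append_iff.mp h₁
        obtain ⟨y, u₃, rfl, rfl, rfl⟩ := List.map_eq_cons_iff.mp hu₂
        refine ⟨y, ⟨u₁, u₃, rfl, fun z hz => ?_⟩, rfl⟩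
        have := hp (z + v.length) (by simp [hz])
        omega
  · rintro ⟨y, ⟨p, q, rfl, hp⟩, rfl⟩
    refine ⟨p.map (fun x => x + v.length), q.map (fun x => x + v.length) ++ v,
      by simp [skewSum], fun z hz => ?_⟩
    obtain ⟨c, hc, rfl⟩ := List.mem_map.mp hz
    have := hp c hc
    dsimp only
    omega

theorem DESB_map_add (w : List ℕ) (k : ℕ) :
    DESB (w.map (fun x => x + k)) = (· + k) '' DESB w := by
  ext x
  constructor
  · rintro ⟨p, q, y, h, hlt⟩
    obtain ⟨w₁, w₂, rfl, rfl, h₂⟩ := List.map_eq_append_iff.mp h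
    obtain ⟨y', w₃, rfl, rfl, h₃⟩ := List.map_eq_cons_iff.mp h₂
    obtain ⟨x', w₄, rfl, rfl, rfl⟩ := List.map_eq_cons_iff.mp h₃
    exact ⟨x', ⟨w₁, w₄, y', rfl, by omega⟩, rfl⟩
  · rintro ⟨x', ⟨p, q, y, rfl, hlt⟩, rfl⟩
    exact ⟨p.map (fun x => x + k), q.map (fun x => x + k), y + k, by simp,
      Nat.add_lt_add_right hlt k⟩

/-- The descent bottoms of `A B` are those of `A`, those of `B`, and the first letter of `B` if it
is smaller than the last letter of `A`. -/
theorem mem_DESB_append {A B : List ℕ} {x : ℕ} : x ∈ DESB (A ++ B) ↔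
    x ∈ DESB A ∨ x ∈ DESB B ∨ (B.head? = some x ∧ ∃ y ∈ A.getLast?, x < y) := by
  constructor
  · rintro ⟨p, q, y, h, hlt⟩
    rcases List.append_eq_append_iff.mp h with ⟨a', h₁, h₂⟩ | ⟨a', h₁, h₂⟩
    · exact Or.inr (Or.inl ⟨a', q, y, h₂, hlt⟩)
    · match a', h₁, h₂ with
      | [], h₁, h₂ => exact Or.inr (Or.inl ⟨[], q, y, by simpa using h₂.symm, hlt⟩)
      | [b], h₁, h₂ =>
        simp only [List.cons_append, List.nil_append, List.cons.injEq] at h₂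
        obtain ⟨rfl, rfl⟩ := h₂
        exact Or.inr (Or.inr ⟨rfl, y, by simp [h₁], hlt⟩)
      | b :: d :: a', h₁, h₂ =>
        simp only [List.cons_append, List.cons.injEq] at h₂
        obtain ⟨rfl, rfl, rfl⟩ := h₂
        exact Or.inl ⟨p, a', y, h₁, hlt⟩
  · rintro (⟨p, q, y, rfl, hlt⟩ | ⟨p, q, y, rfl, hlt⟩ | ⟨hB, y, hA, hlt⟩)
    · exact ⟨p, q ++ B, y, by simp, hlt⟩
    · exact ⟨A ++ p, q, y, by simp, hlt⟩
    · obtain ⟨A', rfl⟩ := List.getLast?_eq_some_iff.mp hA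
      obtain ⟨B', rfl⟩ := List.head?_eq_some_iff.mp hB
      exact ⟨A', B', y, by simp, hlt⟩

theorem DESB_directSum {m n : ℕ} {u v : List ℕ} (hu : IsPerm m u) (hv : IsPerm n v) :
    DESB (directSum u v) = DESB u ∪ (· + u.length) '' DESB v := by
  have hlt := directAt_directSum hu hv
  ext x
  rw [directSum, mem_DESB_append, DESB_map_add]
  constructor
  · rintro (h | h | ⟨h, y, hy, hxy⟩)
    · exact Or.inl h
    · exact Or.inr h
    · have := hlt y (List.mem_of_getLast? hy) x (List.mem_of_head? h)
      omega
  · rintro (h | h)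
    · exact Or.inl h
    · exact Or.inr (Or.inl h)

theorem DESB_skewSum {m n : ℕ} {u v : List ℕ} (hu : IsPerm m u) (hv : IsPerm n v) (h0 : u ≠ []) :
    DESB (skewSum u v) = (· + v.length) '' DESB u ∪ (DESB v ∪ {x | v.head? = some x}) := by
  have hlt := skewAt_skewSum hu hv
  ext x
  rw [skewSum, mem_DESB_append, DESB_map_add]
  constructor
  · rintro (h | h | ⟨h, -⟩)
    · exact Or.inl h
    · exact Or.inr (Or.inl h)
    · exact Or.inr (Or.inr h)
  · rintro (h | h | h)
    · exact Or.inl h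
    · exact Or.inr (Or.inl h)
    · refine Or.inr (Or.inr ⟨h, ?_⟩)
      obtain ⟨y, hy⟩ : ∃ y, (u.map (fun x => x + v.length)).getLast? = some y :=
        Option.ne_none_iff_exists'.mp (by simpa using h0)
      exact ⟨y, hy, hlt y (List.mem_of_getLast? hy) x (List.mem_of_head? h)⟩

/-! ### Trees with the same statistics -/

theorem evalTree_ne_nil (T : BinaryTree Label) : evalTree T ≠ [] := by
  have := length_evalTree T
  intro h
  simp [h] at this

/-- The permutations of the two trees have the same length, first letter, left-to-right maxima,
left-to-right minima and descent bottoms. The first letter is included so that the relation is a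
congruence: it becomes a descent bottom when the permutation is the second part of a skew sum. -/
structure SameStats (S T : BinaryTree Label) : Prop where
  numNodes_eq : S.numNodes = T.numNodes
  head_eq : (evalTree S).head? = (evalTree T).head?
  desb_eq : DESB (evalTree S) = DESB (evalTree T)
  lmax_eq : LMAX (evalTree S) = LMAX (evalTree T)
  lmin_eq : LMIN (evalTree S) = LMIN (evalTree T)

namespace SameStats

theorem refl (T : BinaryTree Label) : SameStats T T := ⟨rfl, rfl, rfl, rfl, rfl⟩

theorem symm {S T : BinaryTree Label} (h : SameStats S T) : SameStats T S :=
  ⟨h.1.symm, h.2.symm, h.3.symm, h.4.symm, h.5.symm⟩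

theorem trans {S T U : BinaryTree Label} (h : SameStats S T) (h' : SameStats T U) :
    SameStats S U :=
  ⟨h.1.trans h'.1, h.2.trans h'.2, h.3.trans h'.3, h.4.trans h'.4, h.5.trans h'.5⟩

theorem of_evalTree_eq {S T : BinaryTree Label} (h : evalTree S = evalTree T) :
    SameStats S T := by
  refine ⟨?_, by rw [h], by rw [h], by rw [h], by rw [h]⟩
  have := congrArg List.length h
  rw [length_evalTree, length_evalTree] at this
  omega

end SameStats

theorem head_directSum {u v : List ℕ} (h0 : u ≠ []) : (directSum u v).head? = u.head? := by
  rw [directSum, List.head?_append_of_ne_nil _ h0]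

theorem head_skewSum {u v : List ℕ} (h0 : u ≠ []) :
    (skewSum u v).head? = u.head?.map (· + v.length) := by
  rw [skewSum, List.head?_append_of_ne_nil _ (by simpa using h0), List.head?_map]

section
variable (l r : BinaryTree Label)

theorem head_oplus : (evalTree (.node .oplus l r)).head? = (evalTree l).head? :=
  head_directSum (evalTree_ne_nil l)

theorem head_ominus : (evalTree (.node .ominus l r)).head? =
    (evalTree l).head?.map (· + (r.numNodes + 1)) := by
  rw [evalTree, head_skewSum (evalTree_ne_nil l), length_evalTree]

theorem DESB_oplus : DESB (evalTree (.node .oplus l r)) =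
    DESB (evalTree l) ∪ (· + (l.numNodes + 1)) '' DESB (evalTree r) := by
  rw [evalTree, DESB_directSum (isPerm_evalTree l) (isPerm_evalTree r), length_evalTree]

theorem DESB_ominus : DESB (evalTree (.node .ominus l r)) =
    (· + (r.numNodes + 1)) '' DESB (evalTree l) ∪
      (DESB (evalTree r) ∪ {x | (evalTree r).head? = some x}) := by
  rw [evalTree, DESB_skewSum (isPerm_evalTree l) (isPerm_evalTree r) (evalTree_ne_nil l),
    length_evalTree]

theorem LMAX_oplus : LMAX (evalTree (.node .oplus l r)) =
    LMAX (evalTree l) ∪ (· + (l.numNodes + 1)) '' LMAX (evalTree r) := by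
  rw [evalTree, LMAX_directSum (isPerm_evalTree l) (isPerm_evalTree r), length_evalTree]

theorem LMAX_ominus : LMAX (evalTree (.node .ominus l r)) =
    (· + (r.numNodes + 1)) '' LMAX (evalTree l) := by
  rw [evalTree, LMAX_skewSum (isPerm_evalTree l) (isPerm_evalTree r) (evalTree_ne_nil l),
    length_evalTree]

theorem LMIN_oplus : LMIN (evalTree (.node .oplus l r)) = LMIN (evalTree l) := by
  rw [evalTree, LMIN_directSum (isPerm_evalTree l) (isPerm_evalTree r) (evalTree_ne_nil l)]

theorem LMIN_ominus : LMIN (evalTree (.node .ominus l r)) =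
    (· + (r.numNodes + 1)) '' LMIN (evalTree l) ∪ LMIN (evalTree r) := by
  rw [evalTree, LMIN_skewSum (isPerm_evalTree l) (isPerm_evalTree r), length_evalTree]

end

theorem SameStats.node {l l' r r' : BinaryTree Label} (a : Label) (hl : SameStats l l')
    (hr : SameStats r r') : SameStats (.node a l r) (.node a l' r') := by
  obtain ⟨l1, l2, l3, l4, l5⟩ := hl
  obtain ⟨r1, r2, r3, r4, r5⟩ := hr
  cases a
  · refine ⟨by simp [BinaryTree.numNodes, l1, r1], ?_, ?_, ?_, ?_⟩
    · simp only [head_oplus, l2]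
    · simp only [DESB_oplus, l1, l3, r3]
    · simp only [LMAX_oplus, l1, l4, r4]
    · simp only [LMIN_oplus, l5]
  · refine ⟨by simp [BinaryTree.numNodes, l1, r1], ?_, ?_, ?_, ?_⟩
    · simp only [head_ominus, l2, r1]
    · simp only [DESB_ominus, l3, r1, r2, r3]
    · simp only [LMAX_ominus, l4, r1]
    · simp only [LMIN_ominus, l5, r1, r5]

/-- `(A ⊕ B) ⊖ C` and `(A ⊖ C) ⊕ B` have the same statistics: in both, `C` lies below `A` and `B`
lies above it, and an upper block does not see whether a lower one comes before it. -/
theorem SameStats.ominus_oplus_comm (A B C : BinaryTree Label) :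
    SameStats (.node .ominus (.node .oplus A B) C) (.node .oplus (.node .ominus A C) B) := by
  have shift (x : ℕ) : x + (A.numNodes + 1) + (C.numNodes + 1) =
      x + (A.numNodes + C.numNodes + 1 + 1) := by omega
  refine ⟨by simp [BinaryTree.numNodes]; omega, ?_, ?_, ?_, ?_⟩
  · simp only [head_ominus, head_oplus]
  · simp only [DESB_ominus, DESB_oplus, BinaryTree.numNodes, Set.image_union, Set.image_image, shift,
      Set.union_assoc]
    congr 1
    rw [Set.union_comm, Set.union_assoc]
  · simp only [LMAX_ominus, LMAX_oplus, BinaryTree.numNodes, Set.image_union, Set.image_image, shift]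
  · simp only [LMIN_ominus, LMIN_oplus]

theorem SameStats.oplus_assoc (A B C : BinaryTree Label) :
    SameStats (.node .oplus (.node .oplus A B) C) (.node .oplus A (.node .oplus B C)) := by
  refine .of_evalTree_eq ?_
  simp [evalTree, directSum, Function.comp_def, add_comm, add_left_comm]

/-! ### Words in the two labels and initial `⊕`s -/

theorem initialOplus_replicate_append (c : ℕ) (s : List Label) :
    initialOplus (List.replicate c .oplus ++ s) = c + initialOplus s := by
  induction c with
  | zero => simp
  | succ c ih =>
    rw [List.replicate_succ, List.cons_append, initialOplus, List.takeWhile_cons_of_pos (by simp),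
      List.length_cons, ← initialOplus, ih]
    omega

theorem initialOplus_ominus_cons (s : List Label) : initialOplus (.ominus :: s) = 0 := by
  simp [initialOplus]

theorem initialOplus_oplus_cons (s : List Label) :
    initialOplus (.oplus :: s) = initialOplus s + 1 := by
  simp [initialOplus]

theorem initialOplus_append {s : List Label} (h : .ominus ∈ s) (t : List Label) :
    initialOplus (s ++ t) = initialOplus s := by
  induction s with
  | nil => simp at h
  | cons a s ih =>
    cases a
    · rw [List.cons_append, initialOplus_oplus_cons, initialOplus_oplus_cons, ih (by simpa using h)]
    · rw [List.cons_append, initialOplus_ominus_cons, initialOplus_ominus_cons]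

/-! ### The spine as a list of blocks -/

/-- The tree obtained from `T` by repeatedly placing a new root on top: a block `(a, R)` adds a root
labelled `a` with left subtree the tree built so far and right subtree `R`. -/
def extend (T : BinaryTree Label) (L : List (Label × BinaryTree Label)) : BinaryTree Label :=
  L.foldl (fun S b => .node b.1 S b.2) T

/-- The spine nodes together with their right subtrees, from the bottom of the spine to the root,
that is, in inorder. -/
def blocks : BinaryTree Label → List (Label × BinaryTree Label)
  | .nil => []
  | .node a l r => blocks l ++ [(a, r)]

theorem extend_append (T : BinaryTree Label) (L L' : List (Label × BinaryTree Label)) :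
    extend T (L ++ L') = extend (extend T L) L' :=
  List.foldl_append

theorem extend_blocks (T : BinaryTree Label) : extend .nil (blocks T) = T := by
  induction T with
  | nil => rfl
  | node a l r ih _ => rw [blocks, extend_append, ih]; rfl

theorem blocks_extend (T : BinaryTree Label) (L : List (Label × BinaryTree Label)) :
    blocks (extend T L) = blocks T ++ L := by
  induction L generalizing T with
  | nil => simp [extend]
  | cons b L ih =>
    change blocks (extend (.node b.1 T b.2) L) = _
    rw [ih, blocks, List.append_assoc]
    rfl

theorem spine_eq (T : BinaryTree Label) : spine T = ((blocks T).map Prod.fst).reverse := by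
  induction T with
  | nil => rfl
  | node a l r ih _ => simp [spine, blocks, ih]

theorem inorder_extend (T : BinaryTree Label) (L : List (Label × BinaryTree Label)) :
    inorder (extend T L) = inorder T ++ L.flatMap fun b => b.1 :: inorder b.2 := by
  induction L generalizing T with
  | nil => simp [extend]
  | cons b L ih =>
    change inorder (extend (.node b.1 T b.2) L) = _
    rw [ih]
    simp [inorder]

theorem isDiSk_extend (T : BinaryTree Label) (L : List (Label × BinaryTree Label)) :
    IsDiSk (extend T L) ↔ IsDiSk T ∧ ∀ b ∈ L, rootLabel b.2 ≠ some b.1 ∧ IsDiSk b.2 := by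
  induction L generalizing T with
  | nil => simp [extend]
  | cons b L ih =>
    change IsDiSk (extend (.node b.1 T b.2) L) ↔ _
    rw [ih]
    simp [IsDiSk]
    tauto

theorem SameStats.extend {T T' : BinaryTree Label} (h : SameStats T T')
    (L : List (Label × BinaryTree Label)) : SameStats (extend T L) (extend T' L) := by
  induction L generalizing T T' with
  | nil => exact h
  | cons b L ih => exact ih (h.node b.1 (.refl b.2))

/-- Blocks labelled `⊕` with the given right subtrees. -/
def oplusBlocks (Q : List (BinaryTree Label)) : List (Label × BinaryTree Label) :=
  Q.map fun q => (.oplus, q)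

/-- Blocks labelled `⊖` with the given right subtrees. -/
def ominusBlocks (M : List (BinaryTree Label)) : List (Label × BinaryTree Label) :=
  M.map fun q => (.ominus, q)

theorem top_extend_oplusBlocks (T : BinaryTree Label) (Q : List (BinaryTree Label)) :
    top (extend T (oplusBlocks Q)) = Q.length + top T := by
  rw [top, top, spine_eq, spine_eq, blocks_extend, List.map_append, List.reverse_append,
    show (oplusBlocks Q).map Prod.fst = List.replicate Q.length .oplus by
      simp [oplusBlocks, Function.comp_def],
    List.reverse_replicate, initialOplus_replicate_append]

theorem spine_extend_oplusBlocks (T : BinaryTree Label) (Q : List (BinaryTree Label)) :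
    .ominus ∈ spine (extend T (oplusBlocks Q)) ↔ .ominus ∈ spine T := by
  simp [spine_eq, blocks_extend, oplusBlocks]

/-- An upper `⊕`-block commutes with any sequence of `⊖`-blocks, as far as the statistics go. -/
theorem SameStats.extend_ominusBlocks_oplus (T q : BinaryTree Label) (M : List (BinaryTree Label)) :
    SameStats (DiSk.extend (.node .oplus T q) (ominusBlocks M))
      (.node .oplus (DiSk.extend T (ominusBlocks M)) q) := by
  induction M generalizing T with
  | nil => exact .refl _
  | cons m M ih => exact ((ominus_oplus_comm T q m).extend _).trans (ih (.node .ominus T m))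

/-! ### Interleaving `⊕`-blocks and `⊖`-blocks -/

/-- Interleave `⊕`-blocks and `⊖`-blocks according to a pattern, in which `some M` stands for a
`⊖`-block with right subtree `M` and `none` for the next of the `⊕`-blocks, whose right subtrees are
listed in `Q`. The `⊕`-blocks that the pattern does not use are placed at the end. -/
def fill : List (Option (BinaryTree Label)) → List (BinaryTree Label) →
    List (Label × BinaryTree Label)
  | [], Q => oplusBlocks Q
  | some M :: p, Q => (.ominus, M) :: fill p Q
  | none :: p, [] => fill p []
  | none :: p, q :: Q => (.oplus, q) :: fill p Q

/-- The right subtrees of the `⊕`-blocks. -/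
def oplusPart (L : List (Label × BinaryTree Label)) : List (BinaryTree Label) :=
  L.filterMap fun b => if b.1 = .oplus then some b.2 else none

/-- The pattern according to which `⊕`-blocks and `⊖`-blocks are interleaved. -/
def pattern (L : List (Label × BinaryTree Label)) : List (Option (BinaryTree Label)) :=
  L.map fun b => if b.1 = .oplus then none else some b.2

theorem fill_pattern (L : List (Label × BinaryTree Label)) : fill (pattern L) (oplusPart L) = L := by
  induction L with
  | nil => rfl
  | cons b L ih =>
    obtain ⟨a, q⟩ := b
    cases a
    · simpa [pattern, oplusPart, fill] using ih
    · simpa [pattern, oplusPart, fill] using ih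

theorem oplusPart_fill (p : List (Option (BinaryTree Label))) (Q : List (BinaryTree Label)) :
    oplusPart (fill p Q) = Q := by
  fun_induction fill p Q with
  | case1 Q => simp [oplusPart, oplusBlocks, List.filterMap_map]
  | case2 M p Q ih => simpa [oplusPart] using ih
  | case3 p ih => exact ih
  | case4 p q Q ih => simpa [oplusPart] using ih

theorem pattern_fill (p : List (Option (BinaryTree Label))) (Q : List (BinaryTree Label))
    (h : p.count none ≤ Q.length) :
    pattern (fill p Q) = p ++ List.replicate (Q.length - p.count none) none := by
  fun_induction fill p Q with
  | case1 Q => simp [pattern, oplusBlocks, Function.comp_def]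
  | case2 M p Q ih => simpa [pattern] using ih (by simpa using h)
  | case3 p ih => simp at h
  | case4 p q Q ih => simpa [pattern] using ih (by simpa using h)

theorem fill_append_replicate (p : List (Option (BinaryTree Label))) (n : ℕ)
    (Q : List (BinaryTree Label)) : fill (p ++ List.replicate n none) Q = fill p Q := by
  fun_induction fill p Q with
  | case1 Q =>
    induction n generalizing Q with
    | zero => rfl
    | succ n ih =>
      cases Q with
      | nil => simpa [List.replicate_succ, fill] using ih []
      | cons q Q => simpa [List.replicate_succ, fill, oplusBlocks] using ih Q
  | case2 M p Q ih => simpa [fill] using ih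
  | case3 p ih => simpa [fill] using ih
  | case4 p q Q ih => simpa [fill] using ih

theorem fill_eq_append (p : List (Option (BinaryTree Label))) (Q : List (BinaryTree Label)) :
    fill p Q = fill p (Q.take (p.count none)) ++ oplusBlocks (Q.drop (p.count none)) := by
  fun_induction fill p Q with
  | case1 Q => simp [fill, oplusBlocks]
  | case2 M p Q ih => simpa [fill] using ih
  | case3 p => simp [fill, oplusBlocks]
  | case4 p q Q ih => simpa [fill] using ih

theorem mem_fill {p : List (Option (BinaryTree Label))} {Q : List (BinaryTree Label)}
    {b : Label × BinaryTree Label} :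
    b ∈ fill p Q ↔ (b.1 = .ominus ∧ some b.2 ∈ p) ∨ (b.1 = .oplus ∧ b.2 ∈ Q) := by
  obtain ⟨a, R⟩ := b
  fun_induction fill p Q with
  | case1 Q => cases a <;> simp [oplusBlocks]
  | case2 M p Q ih => cases a <;> simp [ih]
  | case3 p ih => simp [ih]
  | case4 p q Q ih => cases a <;> simp [ih]

/-- The statistics of a tree depend only on the sequence of `⊕`-blocks and on the sequence of
`⊖`-blocks of the spine, not on how the two are interleaved. -/
theorem SameStats.extend_fill (T : BinaryTree Label) (p : List (Option (BinaryTree Label)))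
    (Q : List (BinaryTree Label)) :
    SameStats (DiSk.extend T (fill p Q))
      (DiSk.extend (DiSk.extend T (ominusBlocks (p.filterMap id))) (oplusBlocks Q)) := by
  fun_induction fill p Q generalizing T with
  | case1 Q => exact .refl _
  | case2 M p Q ih => exact ih (.node .ominus T M)
  | case3 p ih => exact ih T
  | case4 p q Q ih =>
    exact (ih (.node .oplus T q)).trans ((extend_ominusBlocks_oplus T q (p.filterMap id)).extend _)

/-! ### Trees in terms of the position of the lowest `⊖` on the spine -/

/-- The tree whose spine has, from the bottom, `c` nodes `⊕`, then nodes according to the pattern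
`mid`, then nodes `⊕`; the right subtrees of the `⊕`-nodes are listed in `Q`. -/
def assemble (c : ℕ) (mid : List (Option (BinaryTree Label))) (Q : List (BinaryTree Label)) :
    BinaryTree Label :=
  extend .nil (fill (List.replicate c none ++ mid) Q)

/-- A pattern that begins and ends with a `⊖`-block. -/
def Delimited (mid : List (Option (BinaryTree Label))) : Prop :=
  (∃ M p, mid = some M :: p) ∧ ∃ p M, mid = p ++ [some M]

/-- The pattern of the spine, without the top `⊕`-nodes. -/
def lowerPattern (T : BinaryTree Label) : List (Option (BinaryTree Label)) :=
  (pattern (blocks T)).rdropWhile Option.isNone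

/-- The number of `⊕`-nodes below the lowest `⊖`-node of the spine. -/
def bottomOplus (T : BinaryTree Label) : ℕ :=
  ((lowerPattern T).takeWhile Option.isNone).length

/-- The pattern of the spine from its lowest to its highest `⊖`-node. -/
def midPattern (T : BinaryTree Label) : List (Option (BinaryTree Label)) :=
  (lowerPattern T).dropWhile Option.isNone

/-- The right subtrees of the `⊕`-nodes of the spine, from the bottom. -/
def summandList (T : BinaryTree Label) : List (BinaryTree Label) :=
  oplusPart (blocks T)

section
variable {c : ℕ} {mid : List (Option (BinaryTree Label))} {Q : List (BinaryTree Label)}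

theorem summandList_assemble : summandList (assemble c mid Q) = Q := by
  rw [summandList, assemble, blocks_extend, blocks, List.nil_append, oplusPart_fill]

theorem count_replicate_append :
    (List.replicate c none ++ mid).count none = c + mid.count none := by
  rw [List.count_append, List.count_replicate_self]

theorem lowerPattern_assemble (hmid : Delimited mid) (hQ : c + mid.count none ≤ Q.length) :
    lowerPattern (assemble c mid Q) = List.replicate c none ++ mid := by
  rw [lowerPattern, assemble, blocks_extend, blocks, List.nil_append,
    pattern_fill _ _ (by rwa [count_replicate_append])]
  obtain ⟨p, M, rfl⟩ := hmid.2
  rw [List.rdropWhile, List.reverse_append, List.reverse_replicate,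
    List.dropWhile_append_of_pos (by simp)]
  simp

theorem bottomOplus_assemble (hmid : Delimited mid) (hQ : c + mid.count none ≤ Q.length) :
    bottomOplus (assemble c mid Q) = c := by
  rw [bottomOplus, lowerPattern_assemble hmid hQ]
  obtain ⟨M, p, rfl⟩ := hmid.1
  rw [List.takeWhile_append_of_pos (by simp)]
  simp

theorem midPattern_assemble (hmid : Delimited mid) (hQ : c + mid.count none ≤ Q.length) :
    midPattern (assemble c mid Q) = mid := by
  rw [midPattern, lowerPattern_assemble hmid hQ]
  obtain ⟨M, p, rfl⟩ := hmid.1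
  rw [List.dropWhile_append_of_pos (by simp)]
  simp

theorem assemble_eq_extend_oplusBlocks :
    assemble c mid Q = extend
      (assemble c mid (Q.take (c + mid.count none))) (oplusBlocks (Q.drop (c + mid.count none))) := by
  rw [assemble, fill_eq_append, count_replicate_append, extend_append]
  rfl

theorem ominus_mem_spine_assemble (hmid : Delimited mid) :
    .ominus ∈ spine (assemble c mid Q) := by
  obtain ⟨M, p, rfl⟩ := hmid.1
  rw [spine_eq, assemble, blocks_extend, List.mem_reverse, List.mem_map]
  exact ⟨(.ominus, M), by simp [blocks, mem_fill], rfl⟩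

theorem top_assemble (hmid : Delimited mid) (hQ : c + mid.count none ≤ Q.length) :
    top (assemble c mid Q) + c + mid.count none = Q.length := by
  rw [assemble_eq_extend_oplusBlocks, top_extend_oplusBlocks]
  have : top (assemble c mid (Q.take (c + mid.count none))) = 0 := by
    obtain ⟨p, M, rfl⟩ := hmid.2
    have key : ∀ (p : List (Option (BinaryTree Label))) (Q : List (BinaryTree Label)),
        p.count none = Q.length → fill (p ++ [some M]) Q = fill p Q ++ [(.ominus, M)] := by
      intro p Q
      fun_induction fill p Q with
      | case1 Q =>
        intro h
        obtain rfl : Q = [] := List.length_eq_zero_iff.mp (by simpa using h.symm)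
        rfl
      | case2 M p Q ih => intro h; simpa [fill] using ih (by simpa using h)
      | case3 p ih => intro h; simp at h
      | case4 p q Q ih => intro h; simpa [fill] using ih (by simpa using h)
    rw [assemble, ← List.append_assoc, key _ _ (by simp at hQ ⊢; omega), top, spine_eq,
      blocks_extend]
    simp [initialOplus_ominus_cons]
  rw [this, List.length_drop]
  omega

theorem isDiSk_assemble : IsDiSk (assemble c mid Q) ↔
    (∀ M, some M ∈ mid → rootLabel M ≠ some .ominus ∧ IsDiSk M) ∧
      ∀ q ∈ Q, rootLabel q ≠ some .oplus ∧ IsDiSk q := by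
  rw [assemble, isDiSk_extend]
  constructor
  · rintro ⟨-, h⟩
    exact ⟨fun M hM => h (.ominus, M) (mem_fill.mpr (by simp [hM])),
      fun q hq => h (.oplus, q) (mem_fill.mpr (by simp [hq]))⟩
  · rintro ⟨h₁, h₂⟩
    refine ⟨trivial, ?_⟩
    rintro ⟨a, R⟩ hb
    rcases mem_fill.mp hb with ⟨rfl, hb⟩ | ⟨rfl, hb⟩
    · exact h₁ R (by simpa using hb)
    · exact h₂ R hb

theorem SameStats.assemble : SameStats (assemble c mid Q)
    (DiSk.extend (DiSk.extend .nil (ominusBlocks (mid.filterMap id))) (oplusBlocks Q)) := by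
  have := extend_fill .nil (List.replicate c none ++ mid) Q
  rwa [List.filterMap_append, show (List.replicate c none).filterMap id =
    ([] : List (BinaryTree Label)) by simp, List.nil_append] at this

theorem inorder_assemble (hQ : c ≤ Q.length) :
    inorder (assemble c mid Q) = ((Q.take c).flatMap fun q => .oplus :: inorder q) ++
      inorder (assemble 0 mid (Q.drop c)) := by
  rw [assemble, assemble, inorder_extend, inorder_extend]
  simp only [inorder, List.nil_append, List.replicate_zero]
  induction c generalizing Q with
  | zero => simp
  | succ c ih =>
    cases Q with
    | nil => simp at hQ
    | cons q Q => simpa [List.replicate_succ, fill] using ih (by simpa using hQ)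

theorem initialOplus_inorder_assemble_zero (hmid : Delimited mid) :
    initialOplus (inorder (assemble 0 mid Q)) = 0 := by
  obtain ⟨M, p, rfl⟩ := hmid.1
  simp [assemble, inorder_extend, fill, inorder, initialOplus_ominus_cons]

end

theorem exists_replicate_append (L : List (Option (BinaryTree Label))) :
    L = List.replicate (L.takeWhile Option.isNone).length none ++ L.dropWhile Option.isNone := by
  conv_lhs => rw [← List.takeWhile_append_dropWhile (p := Option.isNone) (l := L)]
  congr 1
  exact List.eq_replicate_iff.mpr ⟨rfl, fun b hb => by simpa using List.mem_takeWhile_imp hb⟩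

/-- Every tree with a `⊖` on its spine is determined by the three pieces of data of `assemble`. -/
theorem assemble_data {T : BinaryTree Label} (h : .ominus ∈ spine T) :
    assemble (bottomOplus T) (midPattern T) (summandList T) = T ∧ Delimited (midPattern T) ∧
      bottomOplus T + (midPattern T).count none ≤ (summandList T).length := by
  have hlow : lowerPattern T = List.replicate (bottomOplus T) none ++ midPattern T :=
    exists_replicate_append _
  obtain ⟨n, hn⟩ : ∃ n, pattern (blocks T) = lowerPattern T ++ List.replicate n none := by
    have := congrArg List.reverse (exists_replicate_append (pattern (blocks T)).reverse)
    rw [List.reverse_reverse, List.reverse_append, List.reverse_replicate] at this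
    exact ⟨_, this⟩
  have hfill := fill_pattern (blocks T)
  rw [hn, fill_append_replicate, hlow] at hfill
  have hmem : ∃ M, some M ∈ midPattern T := by
    rw [spine_eq, List.mem_reverse, List.mem_map] at h
    obtain ⟨⟨a, M⟩, hb, rfl⟩ := h
    rw [← hfill, mem_fill] at hb
    exact ⟨M, by simpa using hb⟩
  have hne : midPattern T ≠ [] := by rintro h0; simp [h0] at hmem
  have hlne : lowerPattern T ≠ [] := by rw [hlow]; simp [hne]
  refine ⟨?_, ⟨?_, ?_⟩, ?_⟩
  · rw [assemble, summandList, hfill, extend_blocks]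
  · have := List.head_dropWhile_not (p := Option.isNone) hne
    obtain ⟨M, hM⟩ : ∃ M, (midPattern T).head hne = some M :=
      Option.ne_none_iff_exists'.mp fun h0 =>
        absurd (this.symm.trans (congrArg Option.isNone h0)) (by simp)
    exact ⟨M, (midPattern T).tail, by rw [← hM, List.cons_head_tail]⟩
  · have := List.rdropWhile_last_not Option.isNone (pattern (blocks T)) hlne
    obtain ⟨M, hM⟩ : ∃ M, (lowerPattern T).getLast hlne = some M :=
      Option.ne_none_iff_exists'.mp fun h0 => this (congrArg Option.isNone h0)
    refine ⟨(midPattern T).dropLast, M, ?_⟩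
    rw [← List.dropLast_append_getLast hne, ← hM]
    simp [hlow, hne]
  · have h₁ : (summandList T).length = (pattern (blocks T)).count none := by
      rw [summandList]
      generalize blocks T = L
      induction L with
      | nil => rfl
      | cons b L ih =>
        obtain ⟨a, q⟩ := b
        cases a <;> simpa [pattern, oplusPart] using ih
    rw [h₁, hn, hlow]
    simp
/-! ### The first nontrivial summand -/

/-- The right subtrees of the `⊕`-nodes at the top of the spine, from the bottom, preceded by the
subtree rooted at the topmost `⊖`-node of the spine, if there is one. If there is, the
permutation of the tree is the direct sum of those of the listed trees. -/
def summands : BinaryTree Label → List (BinaryTree Label)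
  | .nil => []
  | .node .oplus l r => summands l ++ [r]
  | .node .ominus l r => [.node .ominus l r]

/-- The iterated direct sum of a list of trees. The empty sum is `nil`, in agreement with
`summands`. -/
def oplusAll : List (BinaryTree Label) → BinaryTree Label
  | [] => .nil
  | q :: X => extend q (oplusBlocks X)

/-- The number of leading empty trees, which stand for single letters. -/
def leadingNil (Q : List (BinaryTree Label)) : ℕ :=
  (Q.takeWhile fun q => decide (q = .nil)).length

/-- The direct sum of the trees after the leading empty ones. -/
def core (Q : List (BinaryTree Label)) : BinaryTree Label :=
  oplusAll (Q.dropWhile fun q => decide (q = .nil))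

theorem summands_extend_oplusBlocks (l r : BinaryTree Label) (X : List (BinaryTree Label)) :
    summands (extend (.node .ominus l r) (oplusBlocks X)) = .node .ominus l r :: X := by
  induction X using List.reverseRecOn with
  | nil => rfl
  | append_singleton X x ih =>
    rw [oplusBlocks, List.map_append, extend_append, ← oplusBlocks]
    change summands (extend _ (oplusBlocks X)) ++ [x] = _
    rw [ih, List.cons_append]

theorem exists_summands {T : BinaryTree Label} (h : .ominus ∈ spine T) :
    ∃ l r X, summands T = .node .ominus l r :: X ∧
      T = extend (.node .ominus l r) (oplusBlocks X) ∧ X.length = top T := by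
  suffices ∃ l r X, T = extend (.node .ominus l r) (oplusBlocks X) by
    obtain ⟨l, r, X, rfl⟩ := this
    refine ⟨l, r, X, summands_extend_oplusBlocks l r X, rfl, ?_⟩
    rw [top_extend_oplusBlocks]
    simp [top, spine, initialOplus_ominus_cons]
  induction T with
  | nil => simp [spine] at h
  | node a l r ih _ =>
    cases a
    · obtain ⟨l', r', X, rfl⟩ := ih (by simpa [spine] using h)
      refine ⟨l', r', X ++ [r], ?_⟩
      conv_rhs => rw [oplusBlocks, List.map_append, extend_append]
      rfl
    · exact ⟨l, r, [], rfl⟩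

theorem length_summands {T : BinaryTree Label} (h : .ominus ∈ spine T) :
    (summands T).length = top T + 1 := by
  obtain ⟨l, r, X, hs, -, hX⟩ := exists_summands h
  rw [hs, List.length_cons, hX]

theorem isDiSk_iff_summands {T : BinaryTree Label} (h : .ominus ∈ spine T) :
    IsDiSk T ↔ ∀ q ∈ summands T, rootLabel q ≠ some .oplus ∧ IsDiSk q := by
  obtain ⟨l, r, X, hs, hT, -⟩ := exists_summands h
  rw [hs, hT, isDiSk_extend]
  simp [oplusBlocks, rootLabel]

section
variable {j : ℕ} {C : BinaryTree Label}

theorem leadingNil_eq (hC : C = .nil ∨ .ominus ∈ spine C) :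
    leadingNil (List.replicate j BinaryTree.nil ++ summands C) = j := by
  rw [leadingNil, List.takeWhile_append_of_pos (by simp)]
  rcases hC with rfl | hC
  · simp [summands]
  · obtain ⟨l, r, X, hs, -, -⟩ := exists_summands hC
    simp [hs]

theorem core_eq (hC : C = .nil ∨ .ominus ∈ spine C) :
    core (List.replicate j BinaryTree.nil ++ summands C) = C := by
  rw [core, List.dropWhile_append_of_pos (by simp)]
  rcases hC with rfl | hC
  · rfl
  · obtain ⟨l, r, X, hs, hX, -⟩ := exists_summands hC
    rw [hs, List.dropWhile_cons_of_neg (by simp), hX]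
    rfl

/-- A list of trees none of which has root `⊕` consists of empty trees (single letters), followed by
the summands of a tree with a `⊖` on its spine, unless all of its members are empty. -/
theorem exists_eq_replicate_append_summands {Q : List (BinaryTree Label)}
    (hQ : ∀ q ∈ Q, rootLabel q ≠ some .oplus) :
    ∃ j C, Q = List.replicate j BinaryTree.nil ++ summands C ∧ (C = .nil ∨ .ominus ∈ spine C) := by
  induction Q with
  | nil => exact ⟨0, .nil, rfl, Or.inl rfl⟩
  | cons q Q ih =>
    match q, hQ q (by simp) with
    | .nil, _ =>
      obtain ⟨j, C, rfl, hC⟩ := ih fun q hq => hQ q (by simp [hq])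
      exact ⟨j + 1, C, rfl, hC⟩
    | .node .oplus l r, h => simp [rootLabel] at h
    | .node .ominus l r, _ =>
      exact ⟨0, extend (.node .ominus l r) (oplusBlocks Q),
        (summands_extend_oplusBlocks l r Q).symm,
        Or.inr ((spine_extend_oplusBlocks _ _).mpr (by simp [spine]))⟩

theorem SameStats.extend_oplusBlocks_assoc (W q : BinaryTree Label)
    (X : List (BinaryTree Label)) :
    SameStats (DiSk.extend (.node .oplus W q) (oplusBlocks X))
      (.node .oplus W (DiSk.extend q (oplusBlocks X))) := by
  induction X generalizing q with
  | nil => exact .refl _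
  | cons x X ih => exact ((oplus_assoc W q x).extend _).trans (ih (.node .oplus q x))

/-- The sum of the summands of `C` may be replaced by the single summand `C`. -/
theorem SameStats.extend_summands (W : BinaryTree Label) (hC : .ominus ∈ spine C) :
    SameStats (DiSk.extend W (oplusBlocks (List.replicate j BinaryTree.nil ++ summands C)))
      (.node .oplus (DiSk.extend W (oplusBlocks (List.replicate j .nil))) C) := by
  obtain ⟨l, r, X, hs, hX, -⟩ := exists_summands hC
  rw [hs, oplusBlocks, List.map_append, extend_append]
  conv_rhs => rw [hX]
  exact extend_oplusBlocks_assoc _ _ X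

/-! ### Initial `⊕`s in terms of the first nontrivial summand -/

variable {c : ℕ} {mid : List (Option (BinaryTree Label))}

theorem iop_assemble_of_le (hmid : Delimited mid) (hc : c ≤ j) (Q : List (BinaryTree Label)) :
    iop (assemble c mid (List.replicate j .nil ++ Q)) = c := by
  rw [iop, inorder_assemble (by simp; omega), List.take_append_of_le_length (by simpa),
    List.take_replicate, min_eq_left hc,
    show (List.replicate c BinaryTree.nil).flatMap (fun q => Label.oplus :: inorder q) =
      List.replicate c .oplus by simp [List.flatMap_replicate, inorder],
    initialOplus_replicate_append, initialOplus_inorder_assemble_zero hmid, add_zero]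

theorem iop_assemble_of_lt (hc : j < c) (hC : .ominus ∈ spine C)
    (hQ : c ≤ (List.replicate j BinaryTree.nil ++ summands C).length) :
    iop (assemble c mid (List.replicate j BinaryTree.nil ++ summands C)) = j + 1 + iop C := by
  obtain ⟨l, r, X, hs, hX, -⟩ := exists_summands hC
  have hmem : .ominus ∈ inorder (.node .ominus l r) := by simp [inorder]
  obtain ⟨d, rfl⟩ := Nat.exists_eq_add_of_lt hc
  have hiop : iop C = initialOplus (inorder (.node .ominus l r)) := by
    rw [iop, hX, inorder_extend, initialOplus_append hmem]
  rw [iop, inorder_assemble hQ, hs, List.take_append, List.length_replicate,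
    show j + d + 1 - j = d + 1 by omega, List.take_succ_cons, List.take_replicate,
    min_eq_right (by omega), List.flatMap_append, List.flatMap_cons,
    show (List.replicate j BinaryTree.nil).flatMap (fun q => Label.oplus :: inorder q) =
      List.replicate j .oplus by simp [List.flatMap_replicate, inorder],
    List.append_assoc, initialOplus_replicate_append, List.append_assoc, List.cons_append,
    initialOplus_oplus_cons, initialOplus_append hmem, hiop]
  omega

end

/-! ### Prescribing the number of initial `⊕`s -/

/-- The parameter that `iop` does not see: if the `⊕`-nodes below the lowest `⊖` of the spine
do not reach the first nontrivial summand, it is the `iop` of the core; otherwise it is the number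
of those `⊕`-nodes beyond the first nontrivial summand. -/
def hiddenOplus (T : BinaryTree Label) : ℕ :=
  if bottomOplus T ≤ leadingNil (summandList T) then iop (core (summandList T))
  else bottomOplus T - leadingNil (summandList T) - 1

/-- The tree with spine pattern `mid` between its lowest and highest `⊖` whose sequence of summands
consists of `j` single letters and a tree obtained from `C`, with `hiddenOplus` equal to `e` and
`iop` equal to `f`. Here `R C i` stands for a tree with `iop` equal to `i`. -/
def normalForm (R : BinaryTree Label → ℕ → BinaryTree Label)
    (mid : List (Option (BinaryTree Label))) (j : ℕ) (C : BinaryTree Label) (e f : ℕ) :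
    BinaryTree Label :=
  if f ≤ j then assemble f mid (List.replicate j BinaryTree.nil ++ summands (R C e))
  else assemble (e + j + 1) mid (List.replicate j BinaryTree.nil ++ summands (R C (f - j - 1)))

/-- Change the `iop` of a tree, given a function `R` that does so for smaller trees. -/
def retargetStep (R : BinaryTree Label → ℕ → BinaryTree Label) (T : BinaryTree Label) (l : ℕ) :
    BinaryTree Label :=
  normalForm R (midPattern T) (leadingNil (summandList T)) (core (summandList T))
    (hiddenOplus T) l

/-- `retarget n T l` is a tree with the same statistics and the same `top + iop` as `T`, and with
`iop` equal to `l`. The first argument bounds the depth of the recursion; it has to exceed the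
number of nodes of `T`. -/
def retarget : ℕ → BinaryTree Label → ℕ → BinaryTree Label
  | 0 => fun T _ => T
  | n + 1 => retargetStep (retarget n)

/-- For all `l` up to `top T + iop T`, the tree `R T l` has `iop` equal to `l`, and the same
statistics and `top + iop` as `T`. The last two fields make `T ↦ R T l` invertible: applying `R` to
`R T l` has the same effect as applying it to `T`, and `R` does nothing if `iop` has the prescribed
value already. -/
structure Retargets (R : BinaryTree Label → ℕ → BinaryTree Label) (T : BinaryTree Label) :
    Prop where
  isDiSk : ∀ l ≤ top T + iop T, IsDiSk (R T l)
  mem_spine : ∀ l ≤ top T + iop T, .ominus ∈ spine (R T l)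
  iop_eq : ∀ l ≤ top T + iop T, iop (R T l) = l
  top_add : ∀ l ≤ top T + iop T, top (R T l) + l = top T + iop T
  sameStats : ∀ l ≤ top T + iop T, SameStats T (R T l)
  comp : ∀ l ≤ top T + iop T, ∀ l' ≤ top T + iop T, R (R T l) l' = R T l'
  self : R T (iop T) = T

section
variable {R : BinaryTree Label → ℕ → BinaryTree Label} {mid : List (Option (BinaryTree Label))}
  {j c e f : ℕ} {C : BinaryTree Label}

theorem retargetStep_assemble (hmid : Delimited mid) (hC : C = .nil ∨ .ominus ∈ spine C)
    (hQ : c + mid.count none ≤ (List.replicate j BinaryTree.nil ++ summands C).length) (l : ℕ) :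
    retargetStep R (assemble c mid (List.replicate j BinaryTree.nil ++ summands C)) l =
      normalForm R mid j C (if c ≤ j then iop C else c - j - 1) l := by
  rw [retargetStep, hiddenOplus, summandList_assemble, bottomOplus_assemble hmid hQ,
    midPattern_assemble hmid hQ, leadingNil_eq hC, core_eq hC]

theorem normalForm_congr {C' : BinaryTree Label} (l : ℕ) (he : R C e = R C' e)
    (hl : j < l → R C (l - j - 1) = R C' (l - j - 1)) :
    normalForm R mid j C e l = normalForm R mid j C' e l := by
  rw [normalForm, normalForm, he]
  split_ifs with h
  · rfl
  · rw [hl (by omega)]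

/-- In both cases of `normalForm`, the parameters `c` and `i` (the number of `⊕`-nodes below the
lowest `⊖`, and the `iop` of the core) satisfy the same bounds, so that enough `⊕`-nodes are
available, and give back `e` and `f`. -/
theorem normalForm_eq_assemble (hR : Retargets R C)
    (he : e ≤ top C + iop C) (h : e + f + mid.count none ≤ top C + iop C + j + 1) :
    ∃ c i, i ≤ top C + iop C ∧
      normalForm R mid j C e f = assemble c mid (List.replicate j BinaryTree.nil ++ summands (R C i)) ∧
      (List.replicate j BinaryTree.nil ++ summands (R C i)).length + i = j + 1 + (top C + iop C) ∧
      c + mid.count none ≤ (List.replicate j BinaryTree.nil ++ summands (R C i)).length ∧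
      c + i = e + f ∧ (if c ≤ j then i else c - j - 1) = e ∧
      (if c ≤ j then c else j + 1 + i) = f := by
  have len : ∀ i ≤ top C + iop C,
      (List.replicate j BinaryTree.nil ++ summands (R C i)).length + i = j + 1 + (top C + iop C) := by
    intro i hi
    rw [List.length_append, List.length_replicate, length_summands (hR.mem_spine i hi)]
    have := hR.top_add i hi
    omega
  rw [normalForm]
  split_ifs with hf
  · have := len e he
    exact ⟨f, e, he, rfl, this, by omega, by omega, if_pos hf, if_pos hf⟩
  · have hi : f - j - 1 ≤ top C + iop C := by omega
    have := len _ hi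
    exact ⟨e + j + 1, f - j - 1, hi, rfl, this, by omega, by omega, by rw [if_neg] <;> omega,
      by rw [if_neg] <;> omega⟩

theorem iop_assemble (hmid : Delimited mid) (hC : .ominus ∈ spine C)
    (hQ : c + mid.count none ≤ (List.replicate j BinaryTree.nil ++ summands C).length) :
    iop (assemble c mid (List.replicate j BinaryTree.nil ++ summands C)) =
      if c ≤ j then c else j + 1 + iop C := by
  split_ifs with hc
  · exact iop_assemble_of_le hmid hc _
  · exact iop_assemble_of_lt (by omega) hC (by omega)

theorem SameStats.assemble_summands (hC : .ominus ∈ spine C) :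
    SameStats (DiSk.assemble c mid (List.replicate j BinaryTree.nil ++ summands C))
      (.node .oplus (DiSk.extend (DiSk.extend .nil (ominusBlocks (mid.filterMap id)))
        (oplusBlocks (List.replicate j .nil))) C) :=
  SameStats.assemble.trans (extend_summands _ hC)

/-- The induction step when there is a nontrivial summand: the tree is then a `normalForm`, and
`retargetStep` changes the parameter `f` only. -/
theorem retargets_assemble (hmid : Delimited mid) (hC : .ominus ∈ spine C)
    (hQ : c + mid.count none ≤ (List.replicate j BinaryTree.nil ++ summands C).length)
    (hT : IsDiSk (assemble c mid (List.replicate j BinaryTree.nil ++ summands C))) (hR : Retargets R C) :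
    Retargets (retargetStep R) (assemble c mid (List.replicate j BinaryTree.nil ++ summands C)) := by
  have htop := top_assemble hmid hQ
  have hiop := iop_assemble hmid hC hQ
  have hlen : (List.replicate j BinaryTree.nil ++ summands C).length = j + 1 + top C := by
    rw [List.length_append, List.length_replicate, length_summands hC]; omega
  have hstep : ∀ l, retargetStep R (assemble c mid (List.replicate j BinaryTree.nil ++ summands C)) l =
      normalForm R mid j C (if c ≤ j then iop C else c - j - 1) l :=
    retargetStep_assemble hmid (Or.inr hC) hQ
  generalize he : (if c ≤ j then iop C else c - j - 1) = e at hstep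
  have he_le : e ≤ top C + iop C := by split_ifs at he <;> omega
  have hsum : top (assemble c mid (List.replicate j BinaryTree.nil ++ summands C)) +
      iop (assemble c mid (List.replicate j BinaryTree.nil ++ summands C)) + e + mid.count none =
        top C + iop C + j + 1 := by
    rw [hiop]
    split_ifs at he ⊢ <;> omega
  have hdisk := isDiSk_assemble.mp hT
  have key : ∀ l, l ≤ top (assemble c mid (List.replicate j BinaryTree.nil ++ summands C)) +
      iop (assemble c mid (List.replicate j BinaryTree.nil ++ summands C)) →
      IsDiSk (normalForm R mid j C e l) ∧ .ominus ∈ spine (normalForm R mid j C e l) ∧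
      iop (normalForm R mid j C e l) = l ∧
      top (normalForm R mid j C e l) + l + e + mid.count none = top C + iop C + j + 1 ∧
      SameStats (assemble c mid (List.replicate j BinaryTree.nil ++ summands C))
        (normalForm R mid j C e l) ∧
      ∀ l', l' ≤ top (assemble c mid (List.replicate j BinaryTree.nil ++ summands C)) +
        iop (assemble c mid (List.replicate j BinaryTree.nil ++ summands C)) →
        retargetStep R (normalForm R mid j C e l) l' = normalForm R mid j C e l' := by
    intro l hl
    obtain ⟨c', i, hi, heq, hlen', hQ', hci, hce, hcf⟩ :=
      normalForm_eq_assemble (mid := mid) (j := j) (f := l) hR he_le (by omega)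
    have hs := hR.mem_spine i hi
    rw [heq]
    refine ⟨isDiSk_assemble.mpr ⟨hdisk.1, fun q hq => ?_⟩, ominus_mem_spine_assemble hmid, ?_, ?_,
      ?_, fun l' hl' => ?_⟩
    · rcases List.mem_append.mp hq with hq | hq
      · rw [List.eq_of_mem_replicate hq]
        simp [rootLabel, IsDiSk]
      · exact (isDiSk_iff_summands hs).mp (hR.isDiSk i hi) q hq
    · rw [iop_assemble hmid hs hQ', hR.iop_eq i hi, hcf]
    · have := top_assemble hmid hQ'
      omega
    · exact (SameStats.assemble_summands hC).trans
        ((SameStats.node _ (.refl _) (hR.sameStats i hi)).trans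
          (SameStats.assemble_summands hs).symm)
    · rw [retargetStep_assemble hmid (Or.inr hs) hQ', hR.iop_eq i hi, hce]
      exact normalForm_congr _ (hR.comp i hi e he_le) fun h => hR.comp i hi _ (by omega)
  refine ⟨fun l hl => ?_, fun l hl => ?_, fun l hl => ?_, fun l hl => ?_, fun l hl => ?_,
    fun l hl l' hl' => ?_, ?_⟩
  · rw [hstep]; exact (key l hl).1
  · rw [hstep]; exact (key l hl).2.1
  · rw [hstep]; exact (key l hl).2.2.1
  · rw [hstep]
    have := (key l hl).2.2.2.1
    omega
  · rw [hstep]; exact (key l hl).2.2.2.2.1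
  · rw [hstep, hstep]; exact (key l hl).2.2.2.2.2 l' hl'
  · rw [hstep, hiop, normalForm]
    by_cases hc : c ≤ j
    · rw [if_pos hc] at he
      rw [if_pos hc, if_pos hc, ← he, hR.self]
    · rw [if_neg hc] at he
      rw [if_neg hc, if_neg (by omega), show j + 1 + iop C - j - 1 = iop C by omega, hR.self,
        show e + j + 1 = c by omega]

/-- The induction step when all summands are single letters: then `retargetStep` just moves
`⊕`-nodes from the top of the spine to its bottom. -/
theorem retargets_assemble_replicate (hmid : Delimited mid)
    (hQ : c + mid.count none ≤ j)
    (hT : IsDiSk (assemble c mid (List.replicate j .nil))) (hR : R .nil 0 = .nil) :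
    Retargets (retargetStep R) (assemble c mid (List.replicate j .nil)) := by
  have hnil : (List.replicate j BinaryTree.nil : List (BinaryTree Label)) =
      List.replicate j BinaryTree.nil ++ summands .nil := by simp [summands]
  have htop {c} (hQ : c + mid.count none ≤ j) :
      top (assemble c mid (List.replicate j .nil)) + c + mid.count none = j := by
    simpa using top_assemble (Q := List.replicate j .nil) hmid (by simpa using hQ)
  have hiop {c} (hQ : c + mid.count none ≤ j) :
      iop (assemble c mid (List.replicate j .nil)) = c := by
    rw [hnil]
    exact iop_assemble_of_le hmid (by omega) _
  have hstep {c l} (hQ : c + mid.count none ≤ j)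
      (hl : l + mid.count none ≤ j) :
      retargetStep R (assemble c mid (List.replicate j .nil)) l =
        assemble l mid (List.replicate j .nil) := by
    have h0 : iop .nil = 0 := rfl
    rw [hnil, retargetStep_assemble hmid (Or.inl rfl) (by simpa [summands] using hQ),
      if_pos (by omega), h0, normalForm, if_pos (by omega), hR]
  have hle {l} (hl : l ≤ top (assemble c mid (List.replicate j .nil)) +
      iop (assemble c mid (List.replicate j .nil))) :
      l + mid.count none ≤ j := by
    have := htop hQ
    have := hiop hQ
    omega
  refine ⟨fun l hl => ?_, fun l hl => ?_, fun l hl => ?_, fun l hl => ?_, fun l hl => ?_,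
    fun l hl l' hl' => ?_, ?_⟩
  · rw [hstep hQ (hle hl)]
    exact isDiSk_assemble.mpr (isDiSk_assemble.mp hT)
  · rw [hstep hQ (hle hl)]
    exact ominus_mem_spine_assemble hmid
  · rw [hstep hQ (hle hl), hiop (hle hl)]
  · rw [hstep hQ (hle hl)]
    have := htop hQ
    have := hiop hQ
    have := htop (hle hl)
    omega
  · rw [hstep hQ (hle hl)]
    exact SameStats.assemble.trans SameStats.assemble.symm
  · rw [hstep hQ (hle hl), hstep (hle hl) (hle hl'), hstep hQ (hle hl')]
  · rw [hiop hQ, hstep hQ hQ]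

end

theorem retarget_nil (n : ℕ) : retarget n .nil 0 = .nil := by
  induction n with
  | zero => rfl
  | succ n ih =>
    change normalForm (retarget n) [] 0 .nil 0 0 = .nil
    rw [normalForm, if_pos le_rfl, ih]
    rfl

theorem retargets_retarget {n : ℕ} {T : BinaryTree Label} (hn : T.numNodes < n) (hT : IsDiSk T)
    (hs : .ominus ∈ spine T) : Retargets (retarget n) T := by
  induction n generalizing T with
  | zero => omega
  | succ n ih =>
    obtain ⟨hasm, hmid, hQ⟩ := assemble_data hs
    generalize bottomOplus T = c at *
    generalize midPattern T = mid at *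
    generalize summandList T = Q at *
    subst hasm
    obtain ⟨j, C, rfl, hC⟩ := exists_eq_replicate_append_summands
      fun q hq => ((isDiSk_assemble.mp hT).2 q hq).1
    rcases hC with rfl | hC
    · rw [summands, List.append_nil] at *
      exact retargets_assemble_replicate hmid (by simpa using hQ) hT (retarget_nil n)
    · refine retargets_assemble hmid hC hQ hT (ih ?_ ?_ hC)
      · have := (SameStats.assemble_summands (c := c) (mid := mid) (j := j) hC).numNodes_eq
        rw [BinaryTree.numNodes] at this
        omega
      · exact (isDiSk_iff_summands hC).mpr fun q hq =>
          (isDiSk_assemble.mp hT).2 q (List.mem_append_right _ hq)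

end DiSk

theorem theorem3p2 (n k l : ℕ) (hn : 1 ≤ n) (hk : 1 ≤ k) :
    ∃ φ : DiSk.DTtilde n k l → DiSk.DTtilde n (k - 1) (l + 1), Function.Bijective φ ∧
      ∀ T : DiSk.DTtilde n k l,
        DiSk.DESB ((DiSk.eta n hn).symm T.1).1 = DiSk.DESB ((DiSk.eta n hn).symm (φ T).1).1 ∧
        DiSk.LMAX ((DiSk.eta n hn).symm T.1).1 = DiSk.LMAX ((DiSk.eta n hn).symm (φ T).1).1 ∧
        DiSk.LMIN ((DiSk.eta n hn).symm T.1).1 = DiSk.LMIN ((DiSk.eta n hn).symm (φ T).1).1 := by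
  have ret : ∀ {k l : ℕ} (T : DiSk.DTtilde n k l),
      DiSk.Retargets (DiSk.retarget n) T.1.1 := fun T =>
    DiSk.retargets_retarget (by have := T.1.2.2; omega) T.1.2.1 T.2.1
  have sum : ∀ {k l : ℕ} (T : DiSk.DTtilde n k l), DiSk.top T.1.1 + DiSk.iop T.1.1 = k + l :=
    fun T => by rw [T.2.2.1, T.2.2.2]
  have change : ∀ {k l : ℕ} (T : DiSk.DTtilde n k l) (k' l' : ℕ), k' + l' = k + l →
      ∃ S : DiSk.DTtilde n k' l', S.1.1 = DiSk.retarget n T.1.1 l' := by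
    intro k l T k' l' h
    have hl : l' ≤ DiSk.top T.1.1 + DiSk.iop T.1.1 := by rw [sum T]; omega
    refine ⟨⟨⟨DiSk.retarget n T.1.1 l', (ret T).isDiSk l' hl, ?_⟩, (ret T).mem_spine l' hl, ?_,
      (ret T).iop_eq l' hl⟩, rfl⟩
    · rw [← ((ret T).sameStats l' hl).numNodes_eq]
      exact T.1.2.2
    · have := (ret T).top_add l' hl
      have := sum T
      dsimp only
      omega
  have comp : ∀ {k l : ℕ} (T : DiSk.DTtilde n k l) (l' : ℕ), l' ≤ k + l →
      DiSk.retarget n (DiSk.retarget n T.1.1 l') l = T.1.1 := by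
    intro k l T l' h
    rw [(ret T).comp l' (by rw [sum T]; omega) l (by rw [sum T]; omega)]
    have := (ret T).self
    rwa [T.2.2.2] at this
  -- The inverse of `φ` sets `iop` back to `l`.
  choose φ hφ using fun T : DiSk.DTtilde n k l => change T (k - 1) (l + 1) (by omega)
  refine ⟨φ, ⟨fun T T' h => ?_, fun S => ?_⟩, fun T => ?_⟩
  · have h' : (φ T).1.1 = (φ T').1.1 := by rw [h]
    rw [hφ, hφ] at h'
    refine Subtype.ext (Subtype.ext ?_)
    rw [← comp T (l + 1) (by omega), h', comp T' (l + 1) (by omega)]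
  · obtain ⟨T, hT⟩ := change S k l (by omega)
    refine ⟨T, Subtype.ext (Subtype.ext ?_)⟩
    rw [hφ, hT]
    exact comp S l (by omega)
  · have h := (ret T).sameStats (l + 1) (by rw [sum T]; omega)
    rw [← hφ] at h
    exact ⟨h.desb_eq, h.lmax_eq, h.lmin_eq⟩
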